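/- A nested regular expression (NRE) is built by the grammar $$E ::= \sigma \mid E\cdot E \mid E\cup E \mid E^* \mid \langle E\rangle ,$$ where $\sigma$ is a role name $p$, an inverse role $p^-$, a test $A?$ for a concept name $A$, or a test $\{a\}?$ for an individual name $a$. An interpretation $\mathcal I$ consists of a nonempty domain $\Delta^{\mathcal I}$ together with an element $a^{\mathcal I}\in\Delta^{\mathcal I}$ for each individual name $a$, a set $A^{\mathcal I}\subseteq\Delta^{\mathcal I}$ for each concept name $A$, and a relation $p^{\mathcal I}\subseteq\Delta^{\mathcal I}\times\Delta^{\mathcal I}$ for each role name $p$. An NRE denotes a binary relation on $\Delta^{\mathcal I}$: $p^-$ denotes the converse of $p^{\mathcal I}$; $A?$ denotes $\{(o,o)\mid o\in A^{\mathcal I}\}$; $\{a\}?$ denotes $\{(a^{\mathcal I},a^{\mathcal I})\}$; $\cdot$, $\cup$ and ${}^*$ denote composition, union and reflexive-transitive closure; and $\langle E\rangle^{\mathcal I}=\{(o,o)\mid \text{there is } o'\in\Delta^{\mathcal I} \text{ with } (o,o')\in E^{\mathcal I}\}$. A nested two-way regular path query (N2RPQ) $q(x,y)$ is an atom $E(x,y)$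 with $E$ an NRE and $x,y$ distinct variables. Its set of answers is $\mathrm{ans}(q,\mathcal I)=\{(\pi(x),\pi(y)) \mid \pi : \{x,y\}\to\Delta^{\mathcal I},\ (\pi(x),\pi(y))\in E^{\mathcal I}\}$. **Theorem.** The following problem is PTIME-hard under logarithmic-space many-one reductions: given as input an N2RPQ $q$, an explicitly listed finite interpretation $\mathcal I$ and a pair $(o,o')\in\Delta^{\mathcal I}\times\Delta^{\mathcal I}$, decide whether $(o,o')\in\mathrm{ans}(q,\mathcal I)$. -/

import Mathlib

/-! # Turing machines, polynomial time, logarithmic space -/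

/-- Head moves. -/
inductive HeadMove where
  | left
  | stay
  | right

/-- Tapes are one-way infinite with cells `0, 1, 2, …`; a left move on cell `0` has no effect. -/
def HeadMove.apply : HeadMove → ℕ → ℕ
  | .left, n => n - 1
  | .stay, n => n
  | .right, n => n + 1

/-- What the input head can see: the left end marker, an input symbol, or the right end marker. -/
inductive InputCell (A : Type) where
  | leftEnd
  | sym (a : A)
  | rightEnd

/-- The read-only input tape `⊢ x ⊣`: cell `0` is `⊢`, cells `1, …, |x|` hold `x`, and
cell `|x| + 1` is `⊣`. -/
def readInput {A : Type} (x : List A) : ℕ → InputCell A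
  | 0 => .leftEnd
  | i + 1 =>
    match x[i]? with
    | some a => .sym a
    | none => .rightEnd

/-- A deterministic multitape off-line Turing machine with input alphabet `A` and output
alphabet `B`: a two-way read-only input tape, finitely many read/write work tapes,
and a one-way write-only output tape. -/
structure Machine (A B : Type) where
  /-- indices of the work tapes -/
  Tape : Type
  /-- states -/
  Q : Type
  /-- work alphabet -/
  Γ : Type
  finTape : Finite Tape
  finQ : Finite Q
  finΓ : Finite Γ
  blank : Γ
  start : Q
  /-- The transition function. From the state, the scanned input cell and the scanned work
  symbols, it either halts (`none`) or gives the next state, the move of the input head, for each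
  work tape the symbol to write and the move to make, and a word to append to the output. -/
  δ : Q → InputCell A → (Tape → Γ) → Option (Q × HeadMove × (Tape → Γ × HeadMove) × List B)

namespace Machine

variable {A B : Type}

/-- Configurations. -/
structure Cfg (M : Machine A B) where
  state : M.Q
  inHead : ℕ
  work : M.Tape → ℕ → M.Γ
  head : M.Tape → ℕ
  out : List B

/-- The initial configuration: work tapes and output are blank, all heads are on cell `0`. -/
def init (M : Machine A B) : M.Cfg where
  state := M.start
  inHead := 0
  work := fun _ _ => M.blank
  head := fun _ => 0
  out := []

/-- One step on input `x`; `none` means that the machine halts. The input head never goes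
beyond the right end marker. -/
def step (M : Machine A B) (x : List A) (c : M.Cfg) : Option M.Cfg :=
  match M.δ c.state (readInput x c.inHead) (fun i => c.work i (c.head i)) with
  | none => none
  | some (q, d, w, o) => some
      { state := q
        inHead := min (d.apply c.inHead) (x.length + 1)
        work := fun i => Function.update (c.work i) (c.head i) (w i).1
        head := fun i => (w i).2.apply (c.head i)
        out := c.out ++ o }

/-- The configuration after `t` steps on input `x` (a halted machine stays where it is). -/
def cfgAt (M : Machine A B) (x : List A) : ℕ → M.Cfg
  | 0 => M.init
  | t + 1 => (M.step x (M.cfgAt x t)).getD (M.cfgAt x t)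

/-- On input `x` the machine has halted after at most `t` steps. -/
def HaltedAt (M : Machine A B) (x : List A) (t : ℕ) : Prop :=
  M.step x (M.cfgAt x t) = none

/-- The machine halts on every input `x`, with output `f x`. -/
def Computes (M : Machine A B) (f : List A → List B) : Prop :=
  ∀ x, ∃ t, M.HaltedAt x t ∧ (M.cfgAt x t).out = f x

/-- The machine visits only `O(log n)` work tape cells on inputs of length `n`. -/
def RunsInLogSpace (M : Machine A B) : Prop :=
  ∃ c : ℕ, ∀ (x : List A) (t : ℕ) (i : M.Tape),
    (M.cfgAt x t).head i ≤ c * (Nat.log 2 x.length + 1)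

end Machine

/-- The class PTIME: `L` is decided, by halting in an accepting or in a nonaccepting state, by a
deterministic Turing machine in a number of steps that is polynomial in the input length. -/
def InPTime {A : Type} (L : Language A) : Prop :=
  ∃ (M : Machine A Empty) (accepting : Set M.Q) (p : Polynomial ℕ), ∀ x : List A,
    ∃ t ≤ p.eval x.length, M.HaltedAt x t ∧ ((M.cfgAt x t).state ∈ accepting ↔ x ∈ L)

/-- `f` is computable in deterministic logarithmic space. -/
def LogSpaceComputable {A B : Type} (f : List A → List B) : Prop :=
  ∃ M : Machine A B, M.Computes f ∧ M.RunsInLogSpace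

/-- Logspace many-one reducibility. -/
def LogSpaceReducible {A B : Type} (L : Language A) (L' : Language B) : Prop :=
  ∃ f : List A → List B, LogSpaceComputable f ∧ ∀ x, x ∈ L ↔ f x ∈ L'

/-- `L'` is PTIME-hard: every language in PTIME, over any finite alphabet, is logspace
many-one reducible to `L'`. -/
def PTimeHard {B : Type} [Finite B] (L' : Language B) : Prop :=
  ∀ (A : Type) [Finite A] (L : Language A), InPTime L → LogSpaceReducible L L'

/-! # Nested two-way regular path queries -/

/-- Names are bit strings. The sets of concept names, role names, individuals and variables are
disjoint copies of this countably infinite set. -/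
abbrev Name := List Bool
abbrev ConceptName := Name
abbrev RoleName := Name
abbrev Individual := Name
abbrev Variable := Name

/-- An interpretation with domain `Δ` (nonempty because of `ind`). -/
structure Interpretation (Δ : Type) where
  ind : Individual → Δ
  concept : ConceptName → Set Δ
  role : RoleName → Set (Δ × Δ)

/-- The symbols of nested regular expressions: `p`, `p⁻`, `{a}?` and `A?`. -/
inductive RoleSymbol where
  | role (p : RoleName)
  | inv (p : RoleName)
  | testInd (a : Individual)
  | testConcept (A : ConceptName)

/-- Nested regular expressions `E ::= σ | E · E | E ∪ E | E* | ⟨E⟩`. -/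
inductive NRE where
  | symbol (σ : RoleSymbol)
  | comp (E₁ E₂ : NRE)
  | union (E₁ E₂ : NRE)
  | star (E : NRE)
  | test (E : NRE)

def RoleSymbol.sem {Δ : Type} (I : Interpretation Δ) : RoleSymbol → Δ → Δ → Prop
  | .role p => fun o o' => (o, o') ∈ I.role p
  | .inv p => fun o o' => (o', o) ∈ I.role p
  | .testInd a => fun o o' => o = o' ∧ o = I.ind a
  | .testConcept A => fun o o' => o = o' ∧ o ∈ I.concept A

/-- The binary relation on `Δ` denoted by a nested regular expression. -/
def NRE.sem {Δ : Type} (I : Interpretation Δ) : NRE → Δ → Δ → Prop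
  | .symbol σ => σ.sem I
  | .comp E₁ E₂ => fun o o' => ∃ u, E₁.sem I o u ∧ E₂.sem I u o'
  | .union E₁ E₂ => fun o o' => E₁.sem I o o' ∨ E₂.sem I o o'
  | .star E => Relation.ReflTransGen (E.sem I)
  | .test E => fun o o' => o = o' ∧ ∃ u, E.sem I o u

/-- A nested two-way regular path query `q(x, y) = E(x, y)`. -/
structure N2RPQ where
  expr : NRE
  x : Variable
  y : Variable
  x_ne_y : x ≠ y

/-- `π` is a match for `q` in `I`. -/
def N2RPQ.IsMatch {Δ : Type} (q : N2RPQ) (I : Interpretation Δ) (π : Variable → Δ) : Prop :=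
  q.expr.sem I (π q.x) (π q.y)

/-- The answers `{(π(x), π(y)) | π is a match for q in I}`. -/
def N2RPQ.ans {Δ : Type} (q : N2RPQ) (I : Interpretation Δ) : Set (Δ × Δ) :=
  {d | ∃ π : Variable → Δ, q.IsMatch I π ∧ d = (π q.x, π q.y)}

/-- A finite interpretation, listed explicitly: the elements of the domain, the
members of the concepts and roles, and the values of individuals. Names that are not listed
are interpreted as the empty concept, the empty role and the element `other`, respectively. -/
structure FiniteInterpretation where
  dom : List Name
  concepts : List (ConceptName × {o // o ∈ dom})
  roles : List (RoleName × {o // o ∈ dom} × {o // o ∈ dom})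
  inds : List (Individual × {o // o ∈ dom})
  other : {o // o ∈ dom}

/-- The domain. -/
abbrev FiniteInterpretation.Dom (I : FiniteInterpretation) : Type := {o // o ∈ I.dom}

/-- The interpretation that is described by the lists. -/
def FiniteInterpretation.toInterpretation (I : FiniteInterpretation) :
    Interpretation I.Dom where
  ind a := (I.inds.lookup a).getD I.other
  concept A := {o | (A, o) ∈ I.concepts}
  role p := {d | (p, d.1, d.2) ∈ I.roles}

/-! # The evaluation problem as a language -/

/-- An instance of the evaluation problem: a query, a finite interpretation and a pair
of elements of its domain. -/
structure EvalInstance where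
  q : N2RPQ
  I : FiniteInterpretation
  o : I.Dom
  o' : I.Dom

/-- The instances with the answer yes. -/
def EvalInstance.IsYes (i : EvalInstance) : Prop :=
  (i.o, i.o') ∈ i.q.ans i.I.toInterpretation

/-- The alphabet in which instances are written down. -/
inductive Token where
  | zero | one | endName
  | item | endList
  | role | inv | testInd | testConcept
  | comp | union | star | test
  deriving DecidableEq

instance : Finite Token :=
  Finite.of_surjective (α := Fin 13)
    ![.zero, .one, .endName, .item, .endList, .role, .inv, .testInd, .testConcept,
      .comp, .union, .star, .test]
    (by
      intro t
      cases t
      exacts [⟨0, rfl⟩, ⟨1, rfl⟩, ⟨2, rfl⟩, ⟨3, rfl⟩, ⟨4, rfl⟩, ⟨5, rfl⟩, ⟨6, rfl⟩, ⟨7, rfl⟩,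
        ⟨8, rfl⟩, ⟨9, rfl⟩, ⟨10, rfl⟩, ⟨11, rfl⟩, ⟨12, rfl⟩])

/-- A name is written as its bits, followed by an end marker. -/
def encName : Name → List Token
  | [] => [.endName]
  | false :: w => .zero :: encName w
  | true :: w => .one :: encName w

/-- In a list, every item is preceded by a marker, and an end marker follows. -/
def encList {α : Type} (e : α → List Token) : List α → List Token
  | [] => [.endList]
  | a :: l => .item :: (e a ++ encList e l)

def encSymbol : RoleSymbol → List Token
  | .role p => .role :: encName p
  | .inv p => .inv :: encName p
  | .testInd a => .testInd :: encName a
  | .testConcept A => .testConcept :: encName A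

/-- Expressions are written in prefix notation. -/
def encNRE : NRE → List Token
  | .symbol σ => encSymbol σ
  | .comp E₁ E₂ => .comp :: (encNRE E₁ ++ encNRE E₂)
  | .union E₁ E₂ => .union :: (encNRE E₁ ++ encNRE E₂)
  | .star E => .star :: encNRE E
  | .test E => .test :: encNRE E

def encQuery (q : N2RPQ) : List Token :=
  encNRE q.expr ++ (encName q.x ++ encName q.y)

def encInterpretation (I : FiniteInterpretation) : List Token :=
  encList encName I.dom ++
  (encList (fun c => encName c.1 ++ encName c.2.1) I.concepts ++
  (encList (fun r => encName r.1 ++ (encName r.2.1.1 ++ encName r.2.2.1)) I.roles ++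
  (encList (fun a => encName a.1 ++ encName a.2.1) I.inds ++
  encName I.other.1)))

def EvalInstance.encode (i : EvalInstance) : List Token :=
  encQuery i.q ++ (encInterpretation i.I ++ (encName i.o.1 ++ encName i.o'.1))

/-- The problem of checking, given an N2RPQ `q`, a finite interpretation `I` and a
pair `(o, o')` of elements of its domain, whether `(o, o') ∈ ans(q, I)`. -/
def N2RPQEvaluation : Language Token :=
  {w | ∃ i : EvalInstance, i.encode = w ∧ i.IsYes}

/-! # Encodings are unambiguous -/

/-- No code word of `e` is a proper prefix of another one, and `e` is injective. -/
def IsPrefixCode {α : Type} (e : α → List Token) : Prop :=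
  ∀ a b u v, e a ++ u = e b ++ v → a = b ∧ u = v

theorem encName_prefixCode : IsPrefixCode encName := by
  intro a
  induction a with
  | nil => intro b u v h; rcases b with _ | ⟨_ | _, b⟩ <;> simp_all [encName]
  | cons x a ih =>
    intro b u v h
    rcases x with _ | _ <;> rcases b with _ | ⟨_ | _, b⟩ <;> simp [encName] at h <;>
      simpa using ih b u v h

theorem IsPrefixCode.list {α : Type} {e : α → List Token} (he : IsPrefixCode e) :
    IsPrefixCode (encList e) := by
  intro a
  induction a with
  | nil => intro b u v h; cases b <;> simp_all [encList]
  | cons x a ih =>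
    intro b u v h
    cases b with
    | nil => simp [encList] at h
    | cons y b =>
      simp only [encList, List.cons_append, List.cons.injEq, true_and, List.append_assoc] at h
      replace h := he _ _ _ _ h; obtain ⟨rfl, h⟩ := h
      replace h := ih _ _ _ h; obtain ⟨rfl, h⟩ := h
      exact ⟨rfl, h⟩

theorem encNRE_prefixCode : IsPrefixCode encNRE := by
  intro a
  induction a with
  | symbol σ =>
    intro b u v h
    rcases b with τ | _ | _ | _ | _ <;> rcases σ with p | p | p | p <;>
      (try rcases τ with r | r | r | r) <;> simp [encNRE, encSymbol] at h <;>
      (replace h := encName_prefixCode _ _ _ _ h; obtain ⟨rfl, h⟩ := h; exact ⟨rfl, h⟩)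
  | comp E F ihE ihF =>
    intro b u v h
    rcases b with (r | r | r | r) | ⟨E', F'⟩ | _ | _ | _ <;> simp [encNRE, encSymbol] at h
    replace h := ihE _ _ _ h; obtain ⟨rfl, h⟩ := h
    replace h := ihF _ _ _ h; obtain ⟨rfl, h⟩ := h
    exact ⟨rfl, h⟩
  | union E F ihE ihF =>
    intro b u v h
    rcases b with (r | r | r | r) | _ | ⟨E', F'⟩ | _ | _ <;> simp [encNRE, encSymbol] at h
    replace h := ihE _ _ _ h; obtain ⟨rfl, h⟩ := h
    replace h := ihF _ _ _ h; obtain ⟨rfl, h⟩ := h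
    exact ⟨rfl, h⟩
  | star E ih =>
    intro b u v h
    rcases b with (r | r | r | r) | _ | _ | E' | _ <;> simp [encNRE, encSymbol] at h
    replace h := ih _ _ _ h; obtain ⟨rfl, h⟩ := h
    exact ⟨rfl, h⟩
  | test E ih =>
    intro b u v h
    rcases b with (r | r | r | r) | _ | _ | _ | E' <;> simp [encNRE, encSymbol] at h
    replace h := ih _ _ _ h; obtain ⟨rfl, h⟩ := h
    exact ⟨rfl, h⟩

theorem encQuery_prefixCode : IsPrefixCode encQuery := by
  rintro ⟨E, x, y, h₁⟩ ⟨E', x', y', h₂⟩ u v h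
  simp only [encQuery, List.append_assoc] at h
  replace h := encNRE_prefixCode _ _ _ _ h; obtain ⟨rfl, h⟩ := h
  replace h := encName_prefixCode _ _ _ _ h; obtain ⟨rfl, h⟩ := h
  replace h := encName_prefixCode _ _ _ _ h; obtain ⟨rfl, h⟩ := h
  exact ⟨rfl, h⟩

theorem encInterpretation_prefixCode : IsPrefixCode encInterpretation := by
  have pairs (d : List Name) :
      IsPrefixCode (fun c : Name × {o // o ∈ d} => encName c.1 ++ encName c.2.1) := by
    rintro ⟨A, o, ho⟩ ⟨A', o', ho'⟩ u v h
    simp only [List.append_assoc] at h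
    replace h := encName_prefixCode _ _ _ _ h; obtain ⟨rfl, h⟩ := h
    replace h := encName_prefixCode _ _ _ _ h; obtain ⟨rfl, h⟩ := h
    exact ⟨rfl, h⟩
  have triples (d : List Name) :
      IsPrefixCode (fun r : Name × {o // o ∈ d} × {o // o ∈ d} =>
        encName r.1 ++ (encName r.2.1.1 ++ encName r.2.2.1)) := by
    rintro ⟨A, ⟨o₁, h₁⟩, ⟨o₂, h₂⟩⟩ ⟨A', ⟨o₁', h₁'⟩, ⟨o₂', h₂'⟩⟩ u v h
    simp only [List.append_assoc] at h
    replace h := encName_prefixCode _ _ _ _ h; obtain ⟨rfl, h⟩ := h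
    replace h := encName_prefixCode _ _ _ _ h; obtain ⟨rfl, h⟩ := h
    replace h := encName_prefixCode _ _ _ _ h; obtain ⟨rfl, h⟩ := h
    exact ⟨rfl, h⟩
  rintro ⟨d, c, r, a, o, ho⟩ ⟨d', c', r', a', o', ho'⟩ u v h
  simp only [encInterpretation, List.append_assoc] at h
  replace h := encName_prefixCode.list _ _ _ _ h; obtain ⟨rfl, h⟩ := h
  replace h := (pairs d).list _ _ _ _ h; obtain ⟨rfl, h⟩ := h
  replace h := (triples d).list _ _ _ _ h; obtain ⟨rfl, h⟩ := h
  replace h := (pairs d).list _ _ _ _ h; obtain ⟨rfl, h⟩ := h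
  replace h := encName_prefixCode _ _ _ _ h; obtain ⟨rfl, h⟩ := h
  exact ⟨rfl, h⟩

theorem EvalInstance.encode_injective : Function.Injective EvalInstance.encode := by
  rintro ⟨q, I, ⟨o₁, h₁⟩, ⟨o₂, h₂⟩⟩ ⟨q', I', ⟨o₁', h₁'⟩, ⟨o₂', h₂'⟩⟩ h
  simp only [EvalInstance.encode] at h
  replace h := encQuery_prefixCode _ _ _ _ h; obtain ⟨rfl, h⟩ := h
  replace h := encInterpretation_prefixCode _ _ _ _ h; obtain ⟨rfl, h⟩ := h
  replace h := encName_prefixCode _ _ _ _ h; obtain ⟨rfl, h⟩ := h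
  obtain ⟨rfl, -⟩ := encName_prefixCode _ _ [] [] (by simpa using h)
  rfl

/-- The code of an instance is in the language if and only if the answer is yes. -/
theorem EvalInstance.encode_mem_iff (i : EvalInstance) :
    i.encode ∈ N2RPQEvaluation ↔ i.IsYes :=
  ⟨fun ⟨_, hj, h⟩ => EvalInstance.encode_injective hj ▸ h, fun h => ⟨i, rfl, h⟩⟩

/-!
Let `M` decide a language in polynomial time. The proof turns an input of `M` into a nested
regular expression and a finite interpretation that describe the run of `M`, and then shows that a
machine with logarithmic space can write them down.

*From machines to rules.* `Machine.rotor` is a reformulation of `M` in which all tapes, and the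
state, are cyclic tapes over `ZMod N` that turn under heads fixed at place `0`. As long as `N`
exceeds the running time, no head of `M` gets around such a tape, so nothing is lost
(`Machine.represents_run`). Now all dependencies are of one kind: what a cell holds after a step
is determined by what some cell held before, and by what the heads, at place `0`, had read. So
"the cell at place `z` of tape `i` holds `v`" is the conclusion of rules, each with a fixed number
of premises of the same form about the previous moment. Time does not appear in the statements, so
there are only `O(N)` of them.

*From rules to a query.* Statements and rules become elements of an interpretation. The expression
`derivation k` tests whether a statement can be derived in exactly `k` rounds: go to a rule with
this conclusion, and check its premises with a nested test of `derivation (k - 1)`. The premises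
are arranged along a chain that is run through with a star, so that `derivation (k - 1)` occurs
only once in `derivation k`, and the expression has length `O(k)`. By `Rotor.derivation_iff` the
statements derived in `k` rounds are those that are true after `k` steps. The query is
`derivation N`, for `N` steps, preceded by a step from a distinguished element to the statements
that `M` is in an accepting state.

*Logarithmic space.* The code of the query and the interpretation consists of a few parts, each of
which is obtained by a loop over the places `d < N`, with a text of constant length in each round
that mentions only `d`, `d + 1`, `d - 1` and `0` modulo `N`. With `N = (b + 2) ^ s`, where `s` is
the bit length of the input length plus one, `d` is a word of `s` digits, and these numbers can be
written, and `d` incremented, by passes over this word from its least significant digit (`Shift`).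
A machine that works with passes over one word of logarithmic length is a logspace machine
(`SweepMachine.logSpaceComputable`), and `Generator.text_logSpaceComputable` applies this to texts
that are written in loops over a counter. For a suitable constant `b`, the number `N` exceeds the
given polynomial (`Polynomial.exists_eval_lt_digits`).
-/

/-! ### Counters: words of digits, least significant digit first -/

/-- The low-order `s` digits of `d` in base `b + 2`, least significant digit first. -/
def digitWord (b : ℕ) : ℕ → ℕ → List (Fin (b + 2))
  | 0, _ => []
  | s + 1, d => Fin.ofNat (b + 2) d :: digitWord b s (d / (b + 2))

@[simp] theorem length_digitWord (b s d : ℕ) : (digitWord b s d).length = s := by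
  induction s generalizing d with
  | zero => rfl
  | succ s ih => simp [digitWord, ih]

theorem digitWord_eq_iff (b s d e : ℕ) :
    digitWord b s d = digitWord b s e ↔ d ≡ e [MOD (b + 2) ^ s] := by
  induction s generalizing d e with
  | zero => simp [digitWord, Nat.modEq_one]
  | succ s ih =>
    simp only [digitWord, List.cons.injEq, ih, Fin.ext_iff, Fin.val_ofNat]
    simp only [Nat.ModEq, pow_succ', Nat.mod_mul]
    constructor
    · rintro ⟨h, h'⟩
      rw [h, h']
    · intro h
      have hd := Nat.mod_lt d (show 0 < b + 2 by omega)
      have he := Nat.mod_lt e (show 0 < b + 2 by omega)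
      have h₁ : d % (b + 2) = e % (b + 2) := by
        have := congrArg (· % (b + 2)) h
        simpa using this
      refine ⟨h₁, ?_⟩
      rw [h₁] at h
      exact Nat.eq_of_mul_eq_mul_left (show 0 < b + 2 by omega) (Nat.add_left_cancel h)

/-- The operations on counters that a single pass from the least significant digit performs. They
are also the states of this pass: `succ` and `pred` stand for a pending carry or borrow, `same`
for none. -/
inductive Shift where
  | same | succ | pred | zero
  deriving DecidableEq

instance : Finite Shift :=
  Finite.of_surjective (α := Fin 4) ![.same, .succ, .pred, .zero] (by
    intro t
    cases t
    exacts [⟨0, rfl⟩, ⟨1, rfl⟩, ⟨2, rfl⟩, ⟨3, rfl⟩])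

namespace Shift

variable {b : ℕ}

/-- The pending operation after a digit, and the new digit. -/
def digit : Shift → Fin (b + 2) → Shift × Fin (b + 2)
  | same, a => (same, a)
  | succ, a => (if a + 1 = 0 then succ else same, a + 1)
  | pred, a => (if a = 0 then pred else same, a - 1)
  | zero, _ => (zero, 0)

/-- The result of the pass over a word. -/
def onWord : Shift → List (Fin (b + 2)) → List (Fin (b + 2))
  | _, [] => []
  | σ, a :: w => (σ.digit a).2 :: (σ.digit a).1.onWord w

/-- What is pending after the pass over a word. -/
def after : Shift → List (Fin (b + 2)) → Shift
  | σ, [] => σ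
  | σ, a :: w => (σ.digit a).1.after w

/-- The operation on residues that a shift of words of fixed length stands for. -/
def onZMod {N : ℕ} : Shift → ZMod N → ZMod N
  | same, z => z
  | succ, z => z + 1
  | pred, z => z - 1
  | zero, _ => 0

@[simp] theorem onWord_same (w : List (Fin (b + 2))) : same.onWord w = w := by
  induction w with
  | nil => rfl
  | cons a w ih => simp [onWord, digit, ih]

@[simp] theorem after_same (w : List (Fin (b + 2))) : same.after w = same := by
  induction w with
  | nil => rfl
  | cons a w ih => simp [after, digit, ih]

theorem onWord_zero (w : List (Fin (b + 2))) : zero.onWord w = digitWord b w.length 0 := by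
  induction w with
  | nil => rfl
  | cons a w ih =>
    simp only [onWord, digit, ih, List.length_cons, digitWord, Nat.zero_div]
    rfl

theorem ofNat_add_one (d : ℕ) : Fin.ofNat (b + 2) d + 1 = Fin.ofNat (b + 2) (d + 1) := by
  ext; simp [Fin.val_add]

theorem ofNat_eq_zero (d : ℕ) : Fin.ofNat (b + 2) d = 0 ↔ b + 2 ∣ d := by
  rw [Fin.ext_iff, Nat.dvd_iff_mod_eq_zero]; simp

theorem onWord_succ (s d : ℕ) :
    succ.onWord (digitWord b s d) = digitWord b s (d + 1) := by
  induction s generalizing d with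
  | zero => rfl
  | succ s ih =>
    simp only [digitWord, onWord, digit, ofNat_add_one, ofNat_eq_zero, Nat.succ_div]
    split_ifs <;> simp [ih]

theorem after_succ (s d : ℕ) :
    succ.after (digitWord b s d) = if (b + 2) ^ s ∣ d + 1 then succ else same := by
  induction s generalizing d with
  | zero => simp [digitWord, after]
  | succ s ih =>
    simp only [digitWord, after, digit, ofNat_add_one, ofNat_eq_zero]
    by_cases h : b + 2 ∣ d + 1
    · rw [if_pos h, ih]
      have h' : d / (b + 2) + 1 = (d + 1) / (b + 2) := by rw [Nat.succ_div, if_pos h]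
      obtain ⟨k, hk⟩ := h
      rw [h', hk, Nat.mul_div_cancel_left _ (by omega), pow_succ']
      simp [Nat.mul_dvd_mul_iff_left]
    · rw [if_neg h, after_same, if_neg]
      exact fun h' => h ((dvd_pow_self _ (by omega)).trans h')

theorem onWord_pred (s d : ℕ) :
    pred.onWord (digitWord b s (d + 1)) = digitWord b s d := by
  induction s generalizing d with
  | zero => rfl
  | succ s ih =>
    simp only [digitWord, onWord, digit, ← ofNat_add_one, add_sub_cancel_right, Nat.succ_div]
    simp only [ofNat_add_one, ofNat_eq_zero]
    split_ifs <;> simp [ih]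

theorem onWord_digitWord {s : ℕ} (σ : Shift) (z : ZMod ((b + 2) ^ s)) :
    σ.onWord (digitWord b s z.val) = digitWord b s (σ.onZMod z).val := by
  have : NeZero ((b + 2) ^ s) := ⟨by positivity⟩
  cases σ with
  | same => simp [onZMod]
  | zero => simp [onZMod, onWord_zero]
  | succ =>
    rw [onWord_succ, digitWord_eq_iff, ← ZMod.natCast_eq_natCast_iff]
    simp [onZMod]
  | pred =>
    rw [← onWord_pred (d := (onZMod pred z).val)]
    congr 1
    rw [digitWord_eq_iff, ← ZMod.natCast_eq_natCast_iff]
    simp [onZMod]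

end Shift

/-! ### Machines that sweep over one work tape -/

instance {A : Type} [Finite A] : Finite (InputCell A) :=
  Finite.of_surjective (α := Option (Option A))
    (fun
      | none => .leftEnd
      | some none => .rightEnd
      | some (some a) => .sym a)
    (by
      rintro (_ | a | _)
      exacts [⟨none, rfl⟩, ⟨some (some a), rfl⟩, ⟨some none, rfl⟩])

/-- A machine whose memory is a word over `D`. In a control state it looks at the input cell, moves
the input head, and starts a pass over the word that rewrites it digit by digit; at the end of
the pass it may append one digit, and it enters the next control state. -/
structure SweepMachine (A B D : Type) where
  /-- control states -/
  S : Type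
  /-- states within a pass -/
  K : Type
  finS : Finite S
  finK : Finite K
  start : S
  /-- The move of the input head, the state in which the pass begins, and a word to output;
  `none` means that the machine halts. -/
  act : S → InputCell A → Option (HeadMove × K × List B)
  /-- The new state, the new digit, and a word to output. -/
  digit : K → D → K × D × List B
  /-- At the end of the pass: the next control state, and a digit to append, if any. -/
  finish : K → S × Option D

namespace SweepMachine

variable {A B D : Type} (P : SweepMachine A B D)

/-- Configurations between two passes. -/
structure Cfg where
  state : P.S
  inHead : ℕ
  word : List D
  out : List B

/-- One pass: the state at its end, the new word and the output. -/
def pass : P.K → List D → P.K × List D × List B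
  | k, [] => (k, [], [])
  | k, a :: w =>
    ((pass (P.digit k a).1 w).1, (P.digit k a).2.1 :: (pass (P.digit k a).1 w).2.1,
      (P.digit k a).2.2 ++ (pass (P.digit k a).1 w).2.2)

theorem pass_cons (k : P.K) (a : D) (w : List D) : P.pass k (a :: w) =
    ((P.pass (P.digit k a).1 w).1, (P.digit k a).2.1 :: (P.pass (P.digit k a).1 w).2.1,
      (P.digit k a).2.2 ++ (P.pass (P.digit k a).1 w).2.2) := rfl

@[simp] theorem length_pass (k : P.K) (w : List D) : (P.pass k w).2.1.length = w.length := by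
  induction w generalizing k with
  | nil => rfl
  | cons a w ih => simp [pass, ih]

/-- The configuration after a pass that begins in state `k`. -/
def afterPass (x : List A) (c : P.Cfg) (mv : HeadMove) (k : P.K) (o : List B) : P.Cfg where
  state := (P.finish (P.pass k c.word).1).1
  inHead := min (mv.apply c.inHead) (x.length + 1)
  word := (P.pass k c.word).2.1 ++ (P.finish (P.pass k c.word).1).2.toList
  out := c.out ++ o ++ (P.pass k c.word).2.2

/-- `P` goes from `c` to `c'` in one pass on input `x`, and the word has at most `L` digits. -/
def Next (x : List A) (L : ℕ) (c c' : P.Cfg) : Prop :=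
  c.word.length ≤ L ∧ ∃ mv k o, P.act c.state (readInput x c.inHead) = some (mv, k, o) ∧
    c' = P.afterPass x c mv k o

/-- The initial configuration. -/
def init : P.Cfg := ⟨P.start, 0, [], []⟩

/-- The Turing machine that carries out the passes. Cell `0` of its work tape is a marker
`some none`, and the word is in the cells that follow. A state is a control state, a state within
a pass, or a control state that is entered once the head is back on the marker. -/
def toMachine [Finite D] : Machine A B where
  Tape := Unit
  Q := P.S ⊕ P.K ⊕ P.S
  Γ := Option (Option D)
  finTape := inferInstance
  finQ := by
    have := P.finS
    have := P.finK
    infer_instance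
  finΓ := inferInstance
  blank := none
  start := .inl P.start
  δ q a g :=
    match q, g () with
    | .inl s, _ =>
      (P.act s a).map fun r => (.inr (.inl r.2.1), r.1, fun _ => (some none, .right), r.2.2)
    | .inr (.inl k), some (some d) =>
      some (.inr (.inl (P.digit k d).1), .stay, fun _ => (some (some (P.digit k d).2.1), .right),
        (P.digit k d).2.2)
    -- The word ends here; if no digit is to be appended, the blank is written back.
    | .inr (.inl k), _ =>
      some (.inr (.inr (P.finish k).1), .stay, fun _ => ((P.finish k).2.map some, .left), [])
    | .inr (.inr s), some (some d) =>
      some (.inr (.inr s), .stay, fun _ => (some (some d), .left), [])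
    | .inr (.inr s), _ => some (.inl s, .stay, fun _ => (some none, .stay), [])

/-- The tape with the word `w`, and with `m` in cell `0`. -/
def tape (m : Option (Option D)) (w : List D) : ℕ → Option (Option D)
  | 0 => m
  | i + 1 => w[i]?.map some

theorem update_tape_append (m : Option (Option D)) (u w : List D) (a a' : D) :
    Function.update (tape m (u ++ a :: w)) (u.length + 1) (some (some a')) =
      tape m (u ++ a' :: w) := by
  funext i
  rcases i with _ | i
  · simp [tape]
  · by_cases h : i = u.length
    · subst h; simp [tape]
    · rw [Function.update_of_ne (by omega)]
      simp only [tape]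
      congr 1
      rcases lt_or_gt_of_ne h with h | h
      · simp [List.getElem?_append_left h]
      · rw [List.getElem?_append_right h.le, List.getElem?_append_right h.le]
        obtain ⟨j, hj⟩ : ∃ j, i - u.length = j + 1 := ⟨i - u.length - 1, by omega⟩
        simp [hj]

theorem update_tape_end (m : Option (Option D)) (u : List D) (a : Option D) :
    Function.update (tape m u) (u.length + 1) (a.map some) = tape m (u ++ a.toList) := by
  funext i
  rcases i with _ | i
  · simp [tape]
  · by_cases h : i = u.length
    · subst h; cases a <;> simp [tape]
    · rw [Function.update_of_ne (by omega)]
      simp only [tape]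
      congr 1
      rcases lt_or_gt_of_ne h with h | h
      · simp [List.getElem?_append_left h]
      · rw [List.getElem?_eq_none h.le, List.getElem?_eq_none]
        cases a <;> simp <;> omega

variable [Finite D]

/-- The configuration of the Turing machine with the given state, word, and head positions. -/
def cfg (q : P.S ⊕ P.K ⊕ P.S) (h : ℕ) (m : Option (Option D)) (w : List D) (j : ℕ)
    (o : List B) : P.toMachine.Cfg where
  state := q
  inHead := h
  work := fun _ => tape m w
  head := fun _ => j
  out := o

/-- A step of the Turing machine whose head is on one of the cells `0, …, L`. -/
def MicroStep (x : List A) (L : ℕ) (c c' : P.toMachine.Cfg) : Prop :=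
  P.toMachine.step x c = some c' ∧ ∀ i, c.head i ≤ L

open Relation in
theorem reach_pass (x : List A) (L h : ℕ) (hh : h ≤ x.length + 1) (k : P.K) (u w : List D)
    (hL : (u ++ w).length + 1 ≤ L) (o : List B) :
    ReflTransGen (P.MicroStep x L) (P.cfg (.inr (.inl k)) h (some none) (u ++ w) (u.length + 1) o)
      (P.cfg (.inr (.inl (P.pass k w).1)) h (some none) (u ++ (P.pass k w).2.1)
        ((u ++ w).length + 1) (o ++ (P.pass k w).2.2)) := by
  induction w generalizing k u o with
  | nil => simp only [pass, List.append_nil]; exact .refl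
  | cons a w ih =>
    have ih := ih (P.digit k a).1 (u ++ [(P.digit k a).2.1]) (by simpa using hL)
      (o ++ (P.digit k a).2.2)
    refine .head (b := P.cfg (.inr (.inl (P.digit k a).1)) h (some none)
      (u ++ (P.digit k a).2.1 :: w) (u.length + 1 + 1) (o ++ (P.digit k a).2.2)) ?_ ?_
    · refine ⟨?_, fun _ => ?_⟩
      · have hs : tape (some none) (u ++ a :: w) (u.length + 1) = some (some a) := by simp [tape]
        simp only [Machine.step, cfg, toMachine, hs, HeadMove.apply, min_eq_left hh,
          update_tape_append]
      · simp only [cfg]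
        simp only [List.length_append] at hL
        omega
    · simpa [pass] using ih

open Relation in
theorem reach_back (x : List A) (L h : ℕ) (hh : h ≤ x.length + 1) (s : P.S) (w : List D)
    (j : ℕ) (hj : j ≤ w.length) (hL : w.length ≤ L) (o : List B) :
    ReflTransGen (P.MicroStep x L) (P.cfg (.inr (.inr s)) h (some none) w j o)
      (P.cfg (.inl s) h (some none) w 0 o) := by
  induction j with
  | zero =>
    refine .single ⟨?_, fun _ => Nat.zero_le _⟩
    have hu : Function.update (tape (some none) w) 0 (some none) = tape (some none) w :=
      Function.update_eq_self 0 (tape (some none) w)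
    simp only [Machine.step, cfg, toMachine, tape, HeadMove.apply, min_eq_left hh, hu,
      List.append_nil]
  | succ j ih =>
    refine .head ⟨?_, fun _ => hj.trans hL⟩ (ih (by omega))
    have hs : tape (some none) w (j + 1) = some (some w[j]) := by
      simp [tape, List.getElem?_eq_getElem (show j < w.length by omega)]
    have hu : Function.update (tape (some none) w) (j + 1) (some (some w[j])) =
        tape (some none) w := by rw [← hs, Function.update_eq_self]
    simp only [Machine.step, cfg, toMachine, hs, HeadMove.apply, min_eq_left hh, hu,
      List.append_nil, Nat.add_sub_cancel]

/-- The configuration of the Turing machine between two passes. -/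
def embed (m : Option (Option D)) (c : P.Cfg) : P.toMachine.Cfg :=
  P.cfg (.inl c.state) c.inHead m c.word 0 c.out

open Relation in
theorem reach_embed (x : List A) (L : ℕ) (m : Option (Option D)) (c c' : P.Cfg)
    (hc : P.Next x L c c') :
    ReflTransGen (P.MicroStep x (L + 1)) (P.embed m c) (P.embed (some none) c') := by
  obtain ⟨hL, mv, k, o, ha, rfl⟩ := hc
  set h := min (mv.apply c.inHead) (x.length + 1) with hh
  have h₀ : P.MicroStep x (L + 1) (P.embed m c)
      (P.cfg (.inr (.inl k)) h (some none) c.word 1 (c.out ++ o)) := by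
    refine ⟨?_, fun _ => Nat.zero_le _⟩
    have hu : Function.update (tape m c.word) 0 (some none) = tape (some none) c.word := by
      funext i
      rcases i with _ | i <;> simp [tape]
    simp only [Machine.step, embed, cfg, toMachine, ha, Option.map_some, hu, HeadMove.apply, hh]
  have h₁ := P.reach_pass x (L + 1) h (min_le_right _ _) k [] c.word (by simpa using hL)
    (c.out ++ o)
  simp only [List.nil_append, List.length_nil, zero_add] at h₁
  set r := P.pass k c.word with hr
  have hlen : r.2.1.length = c.word.length := P.length_pass k c.word
  have h₂ : P.MicroStep x (L + 1)
      (P.cfg (.inr (.inl r.1)) h (some none) r.2.1 (c.word.length + 1) (c.out ++ o ++ r.2.2))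
      (P.cfg (.inr (.inr (P.finish r.1).1)) h (some none) (r.2.1 ++ (P.finish r.1).2.toList)
        c.word.length (c.out ++ o ++ r.2.2)) := by
    refine ⟨?_, fun _ => ?_⟩
    · rw [← hlen]
      have hs : tape (some none) r.2.1 (r.2.1.length + 1) = none := by simp [tape]
      simp only [Machine.step, cfg, toMachine, hs, HeadMove.apply,
        min_eq_left (show h ≤ x.length + 1 from min_le_right _ _), update_tape_end,
        List.append_nil, Nat.add_sub_cancel]
    · simp only [cfg]; omega
  refine .head h₀ (h₁.trans (.head h₂ ?_))
  refine P.reach_back x (L + 1) h (min_le_right _ _) _ _ _ ?_ ?_ _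
  · simp [hlen]
  · cases (P.finish r.1).2 <;> simp [hlen] <;> omega

open Relation in
/-- A bound for the length of the word is a bound for the space: the head of the Turing machine stays
on the word and the two cells next to it. -/
theorem logSpaceComputable {f : List A → List B} (ℓ : ℕ → ℕ) (a : ℕ)
    (hℓ : ∀ n, ℓ n + 1 ≤ a * (Nat.log 2 n + 1))
    (hf : ∀ x, ∃ c : P.Cfg, ReflTransGen (P.Next x (ℓ x.length)) P.init c ∧
      P.act c.state (readInput x c.inHead) = none ∧ c.out = f x) :
    LogSpaceComputable f := by
  have key : ∀ x, ∃ t, P.toMachine.HaltedAt x t ∧ (P.toMachine.cfgAt x t).out = f x ∧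
      ∀ t' i, (P.toMachine.cfgAt x t').head i ≤ ℓ x.length + 1 := by
    intro x
    obtain ⟨c, hc, hhalt, hout⟩ := hf x
    have hreach : ∃ m, ReflTransGen (P.MicroStep x (ℓ x.length + 1)) P.toMachine.init
        (P.embed m c) := by
      clear hhalt hout
      induction hc with
      | refl =>
        refine ⟨none, ?_⟩
        have : P.toMachine.init = P.embed none P.init := by
          simp only [Machine.init, embed, cfg, init, toMachine, Machine.Cfg.mk.injEq, true_and,
            and_true]
          funext _ i
          rcases i with _ | i <;> simp [tape]
        rw [this]
      | tail _ h ih =>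
        obtain ⟨m, hm⟩ := ih
        exact ⟨_, hm.trans (P.reach_embed x _ m _ _ h)⟩
    obtain ⟨m, hm⟩ := hreach
    have htime : ∃ t, P.toMachine.cfgAt x t = P.embed m c ∧
        ∀ t' < t, ∀ i, (P.toMachine.cfgAt x t').head i ≤ ℓ x.length + 1 := by
      generalize P.embed m c = e at hm
      induction hm with
      | refl => exact ⟨0, rfl, by simp⟩
      | tail _ h ih =>
        obtain ⟨t, rfl, ht⟩ := ih
        refine ⟨t + 1, by simp [Machine.cfgAt, h.1], fun t' ht' => ?_⟩
        rcases Nat.lt_succ_iff_lt_or_eq.1 ht' with h' | rfl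
        exacts [ht t' h', h.2]
    obtain ⟨t, ht, hb⟩ := htime
    have hhalt' : P.toMachine.step x (P.embed m c) = none := by
      simp [Machine.step, embed, cfg, toMachine, hhalt]
    have hstay : ∀ k, P.toMachine.cfgAt x (t + k) = P.embed m c := by
      intro k
      induction k with
      | zero => exact ht
      | succ k ih =>
        rw [← add_assoc, Machine.cfgAt, ih, hhalt', Option.getD_none]
    refine ⟨t, by rw [Machine.HaltedAt, ht, hhalt'], by rw [ht]; exact hout, fun t' i => ?_⟩
    rcases lt_or_ge t' t with h | h
    · exact hb t' h i
    · obtain ⟨k, rfl⟩ := Nat.exists_eq_add_of_le h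
      rw [hstay]
      exact Nat.zero_le _
  refine ⟨P.toMachine, fun x => ?_, a, fun x t i => ?_⟩
  · obtain ⟨t, h, h', -⟩ := key x
    exact ⟨t, h, h'⟩
  · obtain ⟨-, -, -, h⟩ := key x
    exact (h t i).trans (hℓ _)

end SweepMachine

/-! ### Texts generated with a counter -/

/-- A piece of a text that mentions a counter: a token, or the value of the counter after an
operation on it. -/
inductive Piece (T : Type) where
  | tok (t : T)
  | num (σ : Shift)

instance {T : Type} [Finite T] : Finite (Piece T) :=
  Finite.of_surjective (α := T ⊕ Shift)
    (fun
      | .inl t => .tok t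
      | .inr σ => .num σ)
    (by
      rintro (t | σ)
      exacts [⟨.inl t, rfl⟩, ⟨.inr σ, rfl⟩])

/-- The text that the pieces stand for when the counter has the value `w` and the digits are
written as `code` says. -/
def render {T : Type} {b : ℕ} (code : Fin (b + 2) → List T) (w : List (Fin (b + 2))) :
    List (Piece T) → List T
  | [] => []
  | .tok t :: l => t :: render code w l
  | .num σ :: l => (σ.onWord w).flatMap code ++ render code w l

theorem render_append {T : Type} {b : ℕ} (code : Fin (b + 2) → List T) (w : List (Fin (b + 2)))
    (l l' : List (Piece T)) :
    render code w (l ++ l') = render code w l ++ render code w l' := by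
  induction l with
  | nil => rfl
  | cons p l ih => cases p <;> simp [render, ih]

theorem render_flatMap {T : Type} {b : ℕ} (code : Fin (b + 2) → List T) (w : List (Fin (b + 2)))
    {α : Type} (g : α → List (Piece T)) (l : List α) :
    render code w (l.flatMap g) = l.flatMap fun a => render code w (g a) := by
  induction l with
  | nil => rfl
  | cons a l ih => simp [render_append, ih]

theorem render_map_tok {T : Type} {b : ℕ} (code : Fin (b + 2) → List T) (w : List (Fin (b + 2)))
    (l : List T) : render code w (l.map .tok) = l := by
  induction l with
  | nil => rfl
  | cons a l ih => simp [render, ih]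

theorem readInput_eq_leftEnd_iff {A : Type} (x : List A) (h : ℕ) :
    readInput x h = .leftEnd ↔ h = 0 := by
  rcases h with _ | h
  · simp [readInput]
  · simp only [readInput]
    split <;> simp

theorem readInput_eq_rightEnd_iff {A : Type} (x : List A) (h : ℕ) :
    readInput x h = .rightEnd ↔ x.length + 1 ≤ h := by
  rcases h with _ | h
  · simp [readInput]
  · simp only [readInput]
    split
    · rename_i a h'
      simpa using (List.getElem?_eq_some_iff.1 h').1
    · simp_all

theorem readInput_min {A : Type} (x : List A) (d : ℕ) :
    readInput x (min d (x.length + 1)) = readInput x d := by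
  rcases le_total d (x.length + 1) with h | h
  · rw [min_eq_left h]
  · rw [min_eq_right h, (readInput_eq_rightEnd_iff x d).2 h, readInput_eq_rightEnd_iff]

/-- A text in `P + 1` parts. Each part is a loop over all values of the counter, followed by a tail
in which the counter is zero. The text of a round of the loop may depend on whether it is the
first one, and on the input cell whose number is the value of the counter. -/
structure Generator (A T : Type) where
  /-- The counter has base `b + 2`. -/
  b : ℕ
  code : Fin (b + 2) → List T
  P : ℕ
  body : Fin (P + 1) → Bool → InputCell A → List (Piece T)
  tail : Fin (P + 1) → List (Piece T)
  /-- A bound for the number of pieces. -/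
  bound : ℕ
  length_body_le : ∀ j f a, (body j f a).length ≤ bound
  length_tail_le : ∀ j, (tail j).length ≤ bound

namespace Generator

variable {A T : Type} (G : Generator A T)

/-- The number of digits of the counter: the bit length of `n + 1`. -/
def digits (n : ℕ) : ℕ := (n + 1).size

/-- The text of a part. -/
def part (x : List A) (j : Fin (G.P + 1)) : List T :=
  ((List.range ((G.b + 2) ^ digits x.length)).flatMap fun d =>
    render G.code (digitWord G.b (digits x.length) d) (G.body j (d == 0) (readInput x d))) ++
  render G.code (digitWord G.b (digits x.length) 0) (G.tail j)

/-- The text that is generated on input `x`. -/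
def text (x : List A) : List T := (List.finRange (G.P + 1)).flatMap (G.part x)

/-- Lists of at most `G.bound` pieces. -/
abbrev Pieces : Type := {l : List (Piece T) // l.length ≤ G.bound}

/-- The control states of the machine that writes the text. -/
inductive State where
  /-- The length of the input is being counted, in binary, up to the input head. -/
  | count
  /-- The input head returns to the left end; then part `j` begins. -/
  | rewind (j : Fin (G.P + 1))
  /-- A round of the loop of part `j` begins. -/
  | round (j : Fin (G.P + 1)) (first : Bool)
  /-- The pieces that remain to be written in a round (or, if `inTail`, in the tail) of part `j`. -/
  | write (j : Fin (G.P + 1)) (inTail : Bool) (l : G.Pieces)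

/-- The states of the machine within a pass over the counter. -/
inductive PassState where
  /-- One is being added in binary. -/
  | count (carry : Bool)
  /-- The operation `σ` is pending. The result is stored if `store`, and it is written to the
  output if `print`. The next state is `ovf` if there is a carry in the end, and `next` if not. -/
  | shift (σ : Shift) (store print : Bool) (next ovf : G.State)

instance [Finite T] : Finite G.Pieces := List.finite_length_le _ _

instance [Finite T] : Finite G.State :=
  Finite.of_surjective
    (α := Unit ⊕ Fin (G.P + 1) ⊕ (Fin (G.P + 1) × Bool) ⊕ (Fin (G.P + 1) × Bool × G.Pieces))
    (fun
      | .inl _ => .count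
      | .inr (.inl j) => .rewind j
      | .inr (.inr (.inl r)) => .round r.1 r.2
      | .inr (.inr (.inr r)) => .write r.1 r.2.1 r.2.2)
    (by
      rintro (_ | j | ⟨j, f⟩ | ⟨j, t, l⟩)
      exacts [⟨.inl (), rfl⟩, ⟨.inr (.inl j), rfl⟩, ⟨.inr (.inr (.inl (j, f))), rfl⟩,
        ⟨.inr (.inr (.inr (j, t, l))), rfl⟩])

instance [Finite T] : Finite G.PassState :=
  Finite.of_surjective (α := Bool ⊕ (Shift × Bool × Bool × G.State × G.State))
    (fun
      | .inl c => .count c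
      | .inr r => .shift r.1 r.2.1 r.2.2.1 r.2.2.2.1 r.2.2.2.2)
    (by
      rintro (c | ⟨σ, s, p, n, o⟩)
      exacts [⟨.inl c, rfl⟩, ⟨.inr (σ, s, p, n, o), rfl⟩])

/-- A pass that changes nothing. -/
def idle (next : G.State) : G.PassState := .shift .same false false next next

/-- What the machine that writes the text does in a control state. -/
def act : G.State → InputCell A → Option (HeadMove × G.PassState × List T)
  | .count, .rightEnd => some (.stay, .shift .zero true false (.rewind 0) (.rewind 0), [])
  | .count, _ => some (.right, .count true, [])
  | .rewind j, .leftEnd => some (.stay, G.idle (.round j true), [])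
  | .rewind j, _ => some (.left, G.idle (.rewind j), [])
  | .round j f, a =>
    some (.stay, G.idle (.write j false ⟨G.body j f a, G.length_body_le j f a⟩), [])
  | .write j t ⟨.tok b :: l, h⟩, _ =>
    some (.stay, G.idle (.write j t ⟨l, (Nat.le_succ _).trans h⟩), [b])
  | .write j t ⟨.num σ :: l, h⟩, _ =>
    some (.stay, .shift σ false true (.write j t ⟨l, (Nat.le_succ _).trans h⟩)
      (.write j t ⟨l, (Nat.le_succ _).trans h⟩), [])
  | .write j false ⟨[], _⟩, _ =>
    some (.right, .shift .succ true false (.round j false)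
      (.write j true ⟨G.tail j, G.length_tail_le j⟩), [])
  | .write j true ⟨[], _⟩, _ =>
    if h : j.val + 1 < G.P + 1 then some (.stay, G.idle (.rewind ⟨j + 1, h⟩), []) else none

/-- The machine that writes the text. -/
abbrev machine [Finite T] : SweepMachine A T (Fin (G.b + 2)) where
  S := G.State
  K := G.PassState
  finS := inferInstance
  finK := inferInstance
  start := .count
  act := G.act
  digit
    | .count true, a => if a = 0 then (.count false, 1, []) else (.count true, 0, [])
    | .count false, a => (.count false, a, [])
    | .shift σ s p n o, a =>
      (.shift (σ.digit a).1 s p n o, if s then (σ.digit a).2 else a,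
        if p then G.code (σ.digit a).2 else [])
  finish
    | .count c => (.count, if c then some 1 else none)
    | .shift σ _ _ n o => (if σ = .succ then o else n, none)

variable [Finite T]

theorem pass_shift (σ : Shift) (s p : Bool) (n o : G.State) (w : List (Fin (G.b + 2))) :
    G.machine.pass (.shift σ s p n o) w =
      (.shift (σ.after w) s p n o, if s then σ.onWord w else w,
        if p then (σ.onWord w).flatMap G.code else []) := by
  induction w generalizing σ with
  | nil => cases s <;> cases p <;> rfl
  | cons a w ih =>
    rw [SweepMachine.pass_cons G.machine]
    have h : G.machine.digit (.shift σ s p n o) a = (.shift (σ.digit a).1 s p n o,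
      if s then (σ.digit a).2 else a, if p then G.code (σ.digit a).2 else []) := rfl
    rw [h]
    simp only [ih, Shift.onWord, Shift.after]
    cases s <;> cases p <;> simp

/-- The binary digits of `n`, as digits of the counter. -/
def bitWord (b n : ℕ) : List (Fin (b + 2)) := n.bits.map fun c => if c then 1 else 0

@[simp] theorem length_bitWord (b n : ℕ) : (bitWord b n).length = n.size := by
  simp [bitWord, Nat.size_eq_bits_len]

theorem pass_count_false (w : List (Fin (G.b + 2))) :
    G.machine.pass (.count false) w = (.count false, w, []) := by
  induction w with
  | nil => rfl
  | cons a w ih =>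
    rw [SweepMachine.pass_cons G.machine]
    have h : G.machine.digit (.count false) a = (.count false, a, []) := rfl
    rw [h]
    simp [ih]

theorem pass_count (n : ℕ) : ∃ c w, G.machine.pass (.count true) (bitWord G.b n) =
    (.count c, w, []) ∧ w ++ (if c then some 1 else none).toList = bitWord G.b (n + 1) := by
  have hd : ∀ a, G.machine.digit (.count true) a =
    if a = 0 then (.count false, 1, []) else (.count true, 0, []) := fun _ => rfl
  induction n using Nat.binaryRec' with
  | zero => exact ⟨true, [], rfl, by simp [bitWord]⟩
  | bit c n hn ih =>
    have hb : bitWord G.b (Nat.bit c n) = (if c then 1 else 0) :: bitWord G.b n := by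
      simp [bitWord, Nat.bits_append_bit n c hn]
    rw [hb, SweepMachine.pass_cons G.machine, hd]
    cases c with
    | false =>
      refine ⟨false, 1 :: bitWord G.b n, by simp [pass_count_false], ?_⟩
      have : Nat.bit false n + 1 = Nat.bit true n := by simp [Nat.bit]
      rw [this]
      simp [bitWord]
    | true =>
      obtain ⟨c', w, h, h'⟩ := ih
      refine ⟨c', 0 :: w, by simp [h], ?_⟩
      have : Nat.bit true n + 1 = Nat.bit false (n + 1) := by simp [Nat.bit]; ring
      rw [this]
      simp only [bitWord, Nat.bits_append_bit (n + 1) false (by simp)] at h' ⊢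
      simp [h']

open Relation

/-- The machine that writes the text goes from `c` to `c'` with at most `digits n` digits. -/
def Reach (x : List A) (c c' : G.machine.Cfg) : Prop :=
  ReflTransGen (G.machine.Next x (digits x.length)) c c'

theorem Reach.refl {x : List A} (c : G.machine.Cfg) : G.Reach x c c := ReflTransGen.refl

variable {G} in
theorem Reach.trans {x : List A} {c c' c'' : G.machine.Cfg} (h : G.Reach x c c')
    (h' : G.Reach x c' c'') : G.Reach x c c'' := ReflTransGen.trans h h'

/-- The configuration of the machine with the given state, input head, counter and output. -/
def cfg (s : G.State) (h : ℕ) (w : List (Fin (G.b + 2))) (o : List T) : G.machine.Cfg :=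
  ⟨s, h, w, o⟩

variable {x : List A}

theorem next_idle {s s' : G.State} {h : ℕ} {w : List (Fin (G.b + 2))} {o : List T} {mv : HeadMove}
    {t : List T} (hw : w.length ≤ digits x.length)
    (ha : G.act s (readInput x h) = some (mv, G.idle s', t)) :
    G.Reach x (G.cfg s h w o) (G.cfg s' (min (mv.apply h) (x.length + 1)) w (o ++ t)) := by
  refine .single ⟨hw, mv, _, t, ha, ?_⟩
  simp [SweepMachine.afterPass, idle, pass_shift, cfg]

theorem next_shift {s n o' : G.State} {h : ℕ} {w : List (Fin (G.b + 2))} {o : List T}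
    {mv : HeadMove} {σ : Shift} {st p : Bool} (hw : w.length ≤ digits x.length)
    (ha : G.act s (readInput x h) = some (mv, .shift σ st p n o', [])) :
    G.Reach x (G.cfg s h w o) (G.cfg (if σ.after w = .succ then o' else n)
      (min (mv.apply h) (x.length + 1)) (if st then σ.onWord w else w)
      (o ++ if p then (σ.onWord w).flatMap G.code else [])) := by
  refine .single ⟨hw, mv, _, [], ha, ?_⟩
  simp [SweepMachine.afterPass, pass_shift, cfg]

theorem reach_write (j : Fin (G.P + 1)) (t : Bool) (l : G.Pieces) (h : ℕ) (hh : h ≤ x.length + 1)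
    (w : List (Fin (G.b + 2))) (hw : w.length ≤ digits x.length) (o : List T) :
    G.Reach x (G.cfg (.write j t l) h w o)
      (G.cfg (.write j t ⟨[], Nat.zero_le _⟩) h w (o ++ render G.code w l.1)) := by
  obtain ⟨l, hl⟩ := l
  induction l generalizing o with
  | nil => simpa [render] using Reach.refl G _
  | cons p l ih =>
    have ih := fun o => ih o ((Nat.le_succ _).trans hl)
    cases p with
    | tok b =>
      have := G.next_idle (x := x) (s := .write j t ⟨.tok b :: l, hl⟩) (h := h) (o := o) hw rfl
      simp only [HeadMove.apply, min_eq_left hh] at this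
      refine this.trans ?_
      simpa [render] using ih (o ++ [b])
    | num σ =>
      have := G.next_shift (x := x) (s := .write j t ⟨.num σ :: l, hl⟩) (h := h) (o := o) hw rfl
      simp only [HeadMove.apply, min_eq_left hh, ite_self, if_true] at this
      refine this.trans ?_
      simpa [render] using ih (o ++ (σ.onWord w).flatMap G.code)

theorem reach_rewind (j : Fin (G.P + 1)) (h : ℕ) (hh : h ≤ x.length + 1)
    (w : List (Fin (G.b + 2))) (hw : w.length ≤ digits x.length) (o : List T) :
    G.Reach x (G.cfg (.rewind j) h w o) (G.cfg (.round j true) 0 w o) := by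
  induction h with
  | zero =>
    have := G.next_idle (x := x) (s := .rewind j) (h := 0) (o := o) hw rfl
    simpa [HeadMove.apply] using this
  | succ h ih =>
    have ha : G.act (.rewind j) (readInput x (h + 1)) = some (.left, G.idle (.rewind j), []) := by
      have : readInput x (h + 1) ≠ .leftEnd := by simp [readInput_eq_leftEnd_iff]
      cases hr : readInput x (h + 1) <;> first | rfl | exact absurd hr this
    have := G.next_idle (o := o) hw ha
    simp only [HeadMove.apply, Nat.add_sub_cancel, List.append_nil] at this
    rw [min_eq_left (by omega)] at this
    exact this.trans (ih (by omega))

/-- A round of a loop, with the addition of one to the counter. The input head stops at the right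
end marker, so that it sees the cell whose number is the value of the counter. -/
theorem reach_round (j : Fin (G.P + 1)) (d : ℕ) (o : List T) :
    G.Reach x
      (G.cfg (.round j (d == 0)) (min d (x.length + 1)) (digitWord G.b (digits x.length) d) o)
      (G.cfg (if (G.b + 2) ^ digits x.length ∣ d + 1 then
          .write j true ⟨G.tail j, G.length_tail_le j⟩ else .round j false)
        (min (d + 1) (x.length + 1)) (digitWord G.b (digits x.length) (d + 1))
        (o ++ render G.code (digitWord G.b (digits x.length) d)
          (G.body j (d == 0) (readInput x d)))) := by
  have hw : (digitWord G.b (digits x.length) d).length ≤ digits x.length := by simp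
  have hh : min d (x.length + 1) ≤ x.length + 1 := min_le_right _ _
  have h₁ := G.next_idle (x := x) (s := .round j (d == 0)) (h := min d (x.length + 1))
    (o := o) hw rfl
  simp only [HeadMove.apply, min_eq_left hh, List.append_nil] at h₁
  have h₂ := G.reach_write (x := x) j false
    ⟨G.body j (d == 0) (readInput x (min d (x.length + 1))), G.length_body_le _ _ _⟩ _ hh _ hw o
  have h₃ := G.next_shift (x := x) (s := .write j false ⟨[], Nat.zero_le _⟩)
    (h := min d (x.length + 1)) (o := o ++ render G.code (digitWord G.b (digits x.length) d)
          (G.body j (d == 0) (readInput x d))) hw rfl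
  rw [readInput_min] at h₁ h₂
  refine (h₁.trans h₂).trans ?_
  have hmin : min (min d (x.length + 1) + 1) (x.length + 1) = min (d + 1) (x.length + 1) := by
    omega
  simp only [HeadMove.apply, hmin, Shift.after_succ, Shift.onWord_succ] at h₃
  by_cases hd : (G.b + 2) ^ digits x.length ∣ d + 1
  · simpa only [if_pos hd, Bool.false_eq_true, if_true, if_false, List.append_nil] using h₃
  · simpa only [if_neg hd, Bool.false_eq_true, reduceCtorEq, if_true, if_false,
      List.append_nil] using h₃

theorem reach_part (j : Fin (G.P + 1)) (o : List T) :
    ∃ h ≤ x.length + 1, G.Reach x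
      (G.cfg (.round j true) 0 (digitWord G.b (digits x.length) 0) o)
      (G.cfg (.write j true ⟨[], Nat.zero_le _⟩) h (digitWord G.b (digits x.length) 0)
        (o ++ G.part x j)) := by
  set s := digits x.length with hs
  -- Round `n` is treated apart, because it is the one that ends with an overflow.
  obtain ⟨n, hn⟩ : ∃ n, (G.b + 2) ^ s = n + 1 := Nat.exists_eq_succ_of_ne_zero (by positivity)
  have loop : ∀ d ≤ n, G.Reach x (G.cfg (.round j true) 0 (digitWord G.b s 0) o)
      (G.cfg (.round j (d == 0)) (min d (x.length + 1)) (digitWord G.b s d)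
        (o ++ (List.range d).flatMap fun d =>
          render G.code (digitWord G.b s d) (G.body j (d == 0) (readInput x d)))) := by
    intro d hd
    induction d with
    | zero => simpa using Reach.refl G _
    | succ d ih =>
      have h := G.reach_round (x := x) j d (o ++ (List.range d).flatMap fun d =>
          render G.code (digitWord G.b s d) (G.body j (d == 0) (readInput x d)))
      rw [if_neg (by
        rw [← hs, hn]
        exact fun h => absurd (Nat.le_of_dvd (Nat.succ_pos d) h) (by omega))] at h
      refine (ih (by omega)).trans ?_
      simpa [List.range_succ] using h
  have h := G.reach_round (x := x) j n (o ++ (List.range n).flatMap fun d =>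
          render G.code (digitWord G.b s d) (G.body j (d == 0) (readInput x d)))
  rw [if_pos (by rw [← hs, hn]), ← hs, (digitWord_eq_iff G.b s (n + 1) 0).2
    (by simp [Nat.ModEq, hn])] at h
  refine ⟨_, min_le_right (n + 1) _, ((loop n le_rfl).trans h).trans ?_⟩
  have h' := G.reach_write (x := x) j true ⟨G.tail j, G.length_tail_le j⟩ (min (n + 1) (x.length + 1))
    (min_le_right _ _) (digitWord G.b s 0) (by simp [hs]) (o ++ (List.range (n + 1)).flatMap fun d =>
          render G.code (digitWord G.b s d) (G.body j (d == 0) (readInput x d)))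
  rw [part, ← hs, hn]
  simpa [List.range_succ] using h'

/-- The initial phase: the length of the input is counted in binary, which gives the counter its
number of digits. -/
theorem reach_count : G.Reach x G.machine.init
    (G.cfg (.round 0 true) 0 (digitWord G.b (digits x.length) 0) []) := by
  have loop : ∀ i ≤ x.length + 1, G.Reach x G.machine.init (G.cfg .count i (bitWord G.b i) []) := by
    intro i hi
    induction i with
    | zero =>
      have : G.machine.init = G.cfg .count 0 (bitWord G.b 0) [] := by simp [bitWord]; rfl
      rw [this]
      exact Reach.refl G _
    | succ i ih =>
      refine (ih (by omega)).trans (.single ⟨?_, .right, .count true, [], ?_, ?_⟩)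
      · simp only [cfg, length_bitWord]
        exact Nat.size_le_size (by omega)
      · have : readInput x i ≠ .rightEnd := by
          rw [Ne, readInput_eq_rightEnd_iff]; omega
        change G.act .count (readInput x i) = _
        cases hr : readInput x i <;> first | rfl | exact absurd hr this
      · obtain ⟨c, w, h, h'⟩ := G.pass_count i
        simp only [SweepMachine.afterPass, cfg, h, h', HeadMove.apply, min_eq_left hi,
          List.append_nil]
  have hw : (bitWord G.b (x.length + 1)).length ≤ digits x.length := by simp [digits]
  have ha : G.act .count (readInput x (x.length + 1)) =
      some (.stay, .shift .zero true false (.rewind 0) (.rewind 0), []) := by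
    rw [(readInput_eq_rightEnd_iff x _).2 le_rfl]; rfl
  have h := G.next_shift (o := []) hw ha
  simp only [HeadMove.apply, min_self, Shift.onWord_zero, ite_self, if_true, length_bitWord] at h
  refine ((loop _ le_rfl).trans h).trans ?_
  exact G.reach_rewind 0 _ le_rfl _ (by simp [digits]) _

theorem reach_parts (i : ℕ) (hi : i < G.P + 1) :
    ∃ h ≤ x.length + 1, G.Reach x G.machine.init
      (G.cfg (.write ⟨i, hi⟩ true ⟨[], Nat.zero_le _⟩) h (digitWord G.b (digits x.length) 0)
        (((List.finRange (G.P + 1)).take (i + 1)).flatMap (G.part x))) := by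
  have htake : ∀ i (hi : i < G.P + 1), (List.finRange (G.P + 1)).take (i + 1) =
      (List.finRange (G.P + 1)).take i ++ [⟨i, hi⟩] := by
    intro i hi
    rw [List.take_succ_eq_append_getElem (by simpa using hi)]
    simp
  induction i with
  | zero =>
    obtain ⟨h, hh, hr⟩ := G.reach_part (x := x) 0 []
    refine ⟨h, hh, G.reach_count.trans ?_⟩
    rw [htake 0 hi]
    simpa using hr
  | succ i ih =>
    obtain ⟨h, hh, hr⟩ := ih (by omega)
    have h₁ := G.next_idle (x := x) (s := .write ⟨i, by omega⟩ true ⟨[], Nat.zero_le _⟩) (h := h)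
      (w := digitWord G.b (digits x.length) 0)
      (o := ((List.finRange (G.P + 1)).take (i + 1)).flatMap (G.part x)) (by simp) (dif_pos hi)
    simp only [HeadMove.apply, min_eq_left hh, List.append_nil] at h₁
    have h₂ := G.reach_rewind (x := x) ⟨i + 1, hi⟩ h hh (digitWord G.b (digits x.length) 0)
      (by simp) (((List.finRange (G.P + 1)).take (i + 1)).flatMap (G.part x))
    obtain ⟨h', hh', h₃⟩ := G.reach_part (x := x) ⟨i + 1, hi⟩
      (((List.finRange (G.P + 1)).take (i + 1)).flatMap (G.part x))
    refine ⟨h', hh', ((hr.trans h₁).trans h₂).trans ?_⟩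
    rw [htake (i + 1) hi]
    simpa using h₃

theorem digits_le (n : ℕ) : digits n + 1 ≤ 3 * (Nat.log 2 n + 1) := by
  have h : digits n ≤ Nat.log 2 n + 2 := by
    rw [digits, Nat.size_le]
    have := Nat.lt_pow_succ_log_self (b := 2) (by norm_num) n
    calc n + 1 ≤ 2 ^ (Nat.log 2 n + 1) := this
      _ < 2 ^ (Nat.log 2 n + 2) := Nat.pow_lt_pow_right (by norm_num) (by omega)
  omega

theorem text_logSpaceComputable : LogSpaceComputable G.text := by
  refine G.machine.logSpaceComputable digits 3 digits_le fun x => ?_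
  obtain ⟨h, -, hr⟩ := G.reach_parts (x := x) G.P (Nat.lt_succ_self _)
  refine ⟨_, hr, dif_neg (by simp), ?_⟩
  change ((List.finRange (G.P + 1)).take (G.P + 1)).flatMap (G.part x) = G.text x
  rw [List.take_of_length_le (by simp), text]

end Generator

/-! ### Machines with rotating cyclic tapes -/

/-- A deterministic machine whose tapes are cyclic and turn under heads that stay at place `0`.
All tapes are read at the same time, and what is read determines what is written on a tape and how
its head moves relative to the tape. -/
structure Rotor (I V : Type) where
  write : (I → V) → I → V
  move : (I → V) → I → HeadMove

/-- A head move as a displacement on a cyclic tape. -/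
def HeadMove.onZMod {N : ℕ} : HeadMove → ZMod N
  | .left => -1
  | .stay => 0
  | .right => 1

/-- The shift that takes a place, relative to the head, to the place after a move of the head. -/
def HeadMove.shift : HeadMove → Shift
  | .left => .succ
  | .stay => .same
  | .right => .pred

theorem HeadMove.onZMod_shift {N : ℕ} (m : HeadMove) (z : ZMod N) :
    m.shift.onZMod z = z - m.onZMod := by
  cases m <;> simp [HeadMove.shift, HeadMove.onZMod, Shift.onZMod]

theorem HeadMove.apply_le (m : HeadMove) (h : ℕ) : m.apply h ≤ h + 1 := by
  cases m <;> simp only [HeadMove.apply] <;> omega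

namespace Rotor

variable {I V : Type} (R : Rotor I V) {N : ℕ}

/-- One step on the contents of the tapes. -/
def step (c : I → ZMod N → V) (i : I) (z : ZMod N) : V :=
  if z + (R.move (fun j => c j 0) i).onZMod = 0 then R.write (fun j => c j 0) i
  else c i (z + (R.move (fun j => c j 0) i).onZMod)

/-- The contents of the tapes after `k` steps from `c`. -/
def run (c : I → ZMod N → V) : ℕ → I → ZMod N → V
  | 0 => c
  | k + 1 => R.step (run c k)

end Rotor

/-! ### Turing machines as machines with rotating tapes -/

namespace Machine

variable {A B : Type} (M : Machine A B)

/-- The tapes of the rotating machine: one whose scanned cell holds the state, the input tape,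
and the work tapes. -/
inductive TapeIx where
  | state
  | input
  | work (i : M.Tape)

/-- What the cells of the rotating machine hold. In a work cell, a mark tells whether it is
cell `0`, where a move to the left has no effect. -/
inductive CellValue where
  | state (q : M.Q)
  | input (a : InputCell A)
  | work (γ : M.Γ) (isFirst : Bool)

instance : Finite M.TapeIx :=
  have := M.finTape
  Finite.of_surjective (α := Option (Option M.Tape))
    (fun
      | none => .state
      | some none => .input
      | some (some i) => .work i)
    (by
      rintro (_ | _ | i)
      exacts [⟨none, rfl⟩, ⟨some none, rfl⟩, ⟨some (some i), rfl⟩])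

instance [Finite A] : Finite M.CellValue :=
  have := M.finQ
  have := M.finΓ
  Finite.of_surjective (α := M.Q ⊕ InputCell A ⊕ (M.Γ × Bool))
    (fun
      | .inl q => .state q
      | .inr (.inl a) => .input a
      | .inr (.inr r) => .work r.1 r.2)
    (by
      rintro (q | a | ⟨γ, f⟩)
      exacts [⟨.inl q, rfl⟩, ⟨.inr (.inl a), rfl⟩, ⟨.inr (.inr (γ, f)), rfl⟩])

namespace CellValue

variable {M}

/-- The state that is held, or an arbitrary one. -/
def getState : M.CellValue → M.Q
  | .state q => q
  | _ => M.start

/-- The input cell that is held, or an arbitrary one. -/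
def getInput : M.CellValue → InputCell A
  | .input a => a
  | _ => .leftEnd

/-- The work symbol that is held, or an arbitrary one. -/
def getSymbol : M.CellValue → M.Γ
  | .work γ _ => γ
  | _ => M.blank

/-- Whether this is cell `0` of a work tape. -/
def isFirst : M.CellValue → Bool
  | .work _ f => f
  | _ => false

end CellValue

/-- The transition for the scanned values `v`. -/
def view (v : M.TapeIx → M.CellValue) :
    Option (M.Q × HeadMove × (M.Tape → M.Γ × HeadMove) × List B) :=
  M.δ (v .state).getState (v .input).getInput fun i => (v (.work i)).getSymbol

/-- The move of the input head that has an effect when `a` is scanned. -/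
def inputMove : InputCell A → HeadMove → HeadMove
  | .leftEnd, .left => .stay
  | .rightEnd, .right => .stay
  | _, m => m

/-- The move of a work head that has an effect, where `f` tells whether it is on cell `0`. -/
def workMove : Bool → HeadMove → HeadMove
  | true, .left => .stay
  | _, m => m

/-- The rotating machine that simulates `M`. It stands still when `M` has halted. -/
def rotor : Rotor M.TapeIx M.CellValue where
  write v i :=
    match M.view v, i with
    | some r, .state => .state r.1
    | some r, .work t => .work (r.2.2.1 t).1 (v (.work t)).isFirst
    | _, i => v i
  move v i :=
    match M.view v, i with
    | some r, .input => inputMove (v .input).getInput r.2.1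
    | some r, .work t => workMove (v (.work t)).isFirst (r.2.2.1 t).2
    | _, _ => .stay

/-- The initial contents of a cell of the rotating machine, given whether it is cell `0` and the
contents of the corresponding input cell. -/
def initValue (first : Bool) (a : InputCell A) : M.TapeIx → M.CellValue
  | .state => .state M.start
  | .input => .input a
  | .work _ => .work M.blank first

/-- The initial contents of the tapes of the rotating machine. -/
def initTapes (x : List A) (N : ℕ) (i : M.TapeIx) (z : ZMod N) : M.CellValue :=
  M.initValue (z.val == 0) (readInput x z.val) i

/-- The contents `c` of the rotating tapes represent the configuration `e` of `M`. -/
structure Represents (x : List A) {N : ℕ} (c : M.TapeIx → ZMod N → M.CellValue) (e : M.Cfg) :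
    Prop where
  state : c .state 0 = .state e.state
  input : ∀ z, c .input z = .input (readInput x ((e.inHead : ZMod N) + z).val)
  work : ∀ i z, c (.work i) z =
    .work (e.work i ((e.head i : ZMod N) + z).val) (((e.head i : ZMod N) + z).val == 0)

variable {M} {x : List A} {N : ℕ}

theorem represents_init : M.Represents x (M.initTapes x N) M.init where
  state := rfl
  input z := by simp [initTapes, initValue, init]
  work i z := by simp [initTapes, initValue, init]

theorem cast_inputMove (h : ℕ) (hh : h ≤ x.length + 1) (m : HeadMove) :
    ((min (m.apply h) (x.length + 1) : ℕ) : ZMod N) =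
      (h : ZMod N) + (inputMove (readInput x h) m).onZMod := by
  cases m with
  | left =>
    rcases h with _ | h
    · simp [HeadMove.apply, readInput, inputMove, HeadMove.onZMod]
    · have : inputMove (readInput x (h + 1)) .left = .left := by
        have := (readInput_eq_leftEnd_iff x (h + 1)).not.2 (by omega)
        cases hr : readInput x (h + 1) <;> first | rfl | exact absurd hr this
      rw [this, HeadMove.apply, Nat.add_sub_cancel, min_eq_left (by omega)]
      simp [HeadMove.onZMod]
  | stay =>
    have : inputMove (readInput x h) .stay = .stay := by cases readInput x h <;> rfl
    simp [this, HeadMove.apply, HeadMove.onZMod, min_eq_left hh]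
  | right =>
    rcases hh.eq_or_lt with rfl | hh
    · rw [(readInput_eq_rightEnd_iff x _).2 le_rfl]
      simp [HeadMove.apply, inputMove, HeadMove.onZMod]
    · have : inputMove (readInput x h) .right = .right := by
        have := (readInput_eq_rightEnd_iff x h).not.2 (by omega)
        cases hr : readInput x h <;> first | rfl | exact absurd hr this
      rw [this, HeadMove.apply, min_eq_left (by omega)]
      simp [HeadMove.onZMod]

theorem cast_workMove (h : ℕ) (m : HeadMove) :
    ((m.apply h : ℕ) : ZMod N) = (h : ZMod N) + (workMove (h == 0) m).onZMod := by
  rcases h with _ | h <;> cases m <;> simp [HeadMove.apply, workMove, HeadMove.onZMod]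

theorem step_of_represents [NeZero N] {c : M.TapeIx → ZMod N → M.CellValue} {e : M.Cfg}
    (hr : M.Represents x c e) (hx : e.inHead ≤ x.length + 1) (hi : e.inHead < N)
    (hw : ∀ i, e.head i < N) :
    M.Represents x (M.rotor.step c) ((M.step x e).getD e) := by
  have hv : M.view (fun j => c j 0) = M.δ e.state (readInput x e.inHead)
      fun i => e.work i (e.head i) := by
    simp [view, hr.state, hr.input, hr.work, CellValue.getState, CellValue.getInput,
      CellValue.getSymbol, ZMod.val_natCast, Nat.mod_eq_of_lt, hi, hw]
  cases hd : M.δ e.state (readInput x e.inHead) (fun i => e.work i (e.head i)) with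
  | none =>
    have hs : M.step x e = none := by simp [step, hd]
    have hc : M.rotor.step c = c := by
      funext i z
      cases i <;> simp +contextual [Rotor.step, rotor, hv, hd, HeadMove.onZMod]
    rw [hs, hc]
    exact hr
  | some r =>
    obtain ⟨q, d, w, o⟩ := r
    rw [hd] at hv
    have hs : (M.step x e).getD e =
        { state := q
          inHead := min (d.apply e.inHead) (x.length + 1)
          work := fun i => Function.update (e.work i) (e.head i) (w i).1
          head := fun i => (w i).2.apply (e.head i)
          out := e.out ++ o } := by simp [step, hd]
    rw [hs]
    constructor
    · simp [Rotor.step, rotor, hv, HeadMove.onZMod]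
    · intro z
      have hm : M.rotor.move (fun j => c j 0) .input = inputMove (readInput x e.inHead) d := by
        simp [rotor, hv, hr.input, CellValue.getInput, ZMod.val_natCast, Nat.mod_eq_of_lt, hi]
      have hwr : M.rotor.write (fun j => c j 0) .input = c .input 0 := by
        simp [rotor, hv]
      have : M.rotor.step c .input z =
          c .input (z + (inputMove (readInput x e.inHead) d).onZMod) := by
        rw [Rotor.step, hm, hwr]
        split_ifs with h
        · rw [h]
        · rfl
      rw [this, hr.input, cast_inputMove _ hx]
      congr 3
      ring
    · intro i z
      have hval : ((e.head i : ZMod N)).val = e.head i := by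
        rw [ZMod.val_natCast, Nat.mod_eq_of_lt (hw i)]
      have hf : (c (.work i) 0).isFirst = (e.head i == 0) := by
        simp [hr.work, CellValue.isFirst, hval]
      have hm : M.rotor.move (fun j => c j 0) (.work i) = workMove (e.head i == 0) (w i).2 := by
        simp [rotor, hv, hf]
      have hwr : M.rotor.write (fun j => c j 0) (.work i) = .work (w i).1 (e.head i == 0) := by
        simp [rotor, hv, hf]
      rw [Rotor.step, hm, hwr, cast_workMove, hr.work]
      set u := (workMove (e.head i == 0) (w i).2).onZMod (N := N)
      have hz : (e.head i : ZMod N) + u + z = e.head i + (z + u) := by ring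
      rw [hz]
      split_ifs with h
      · simp [h, hval]
      · dsimp only
        rw [Function.update_of_ne]
        intro h'
        rw [← hval] at h'
        exact h (by simpa using ZMod.val_injective N h')

theorem inHead_le (x : List A) (k : ℕ) : (M.cfgAt x k).inHead ≤ x.length + 1 := by
  induction k with
  | zero => simp [cfgAt, init]
  | succ k ih =>
    rw [cfgAt, step]
    split
    · exact ih
    · exact min_le_right _ _

theorem heads_le (x : List A) (k : ℕ) :
    (M.cfgAt x k).inHead ≤ k ∧ ∀ i, (M.cfgAt x k).head i ≤ k := by
  induction k with
  | zero => simp [cfgAt, init]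
  | succ k ih =>
    rw [cfgAt, step]
    split
    · exact ⟨ih.1.trans (Nat.le_succ k), fun i => (ih.2 i).trans (Nat.le_succ k)⟩
    · refine ⟨(min_le_left _ _).trans ((HeadMove.apply_le _ _).trans (by simpa using ih.1)),
        fun i => (HeadMove.apply_le _ _).trans (by simpa using ih.2 i)⟩

theorem cfgAt_of_haltedAt {t : ℕ} (ht : M.HaltedAt x t) {k : ℕ} (hk : t ≤ k) :
    M.cfgAt x k = M.cfgAt x t := by
  induction k, hk using Nat.le_induction with
  | base => rfl
  | succ k _ ih =>
    rw [HaltedAt] at ht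
    rw [cfgAt, ih, ht, Option.getD_none]

/-- If `M` halts before its heads can go around the cyclic tapes, then the rotating machine
simulates it forever. -/
theorem represents_run [NeZero N] {t : ℕ} (ht : M.HaltedAt x t) (htN : t < N) (k : ℕ) :
    M.Represents x (M.rotor.run (M.initTapes x N) k) (M.cfgAt x k) := by
  induction k with
  | zero => exact represents_init
  | succ k ih =>
    have h : (M.cfgAt x k).inHead < N ∧ ∀ i, (M.cfgAt x k).head i < N := by
      rcases le_total k t with h | h
      · exact ⟨(heads_le x k).1.trans_lt (h.trans_lt htN),
          fun i => ((heads_le x k).2 i).trans_lt (h.trans_lt htN)⟩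
      · rw [cfgAt_of_haltedAt ht h]
        exact ⟨(heads_le x t).1.trans_lt htN, fun i => ((heads_le x t).2 i).trans_lt htN⟩
    exact step_of_represents ih (inHead_le x k) h.1 h.2

end Machine

/-! ### Names and codes -/

/-- The token for a bit. -/
def bitToken : Bool → Token
  | false => .zero
  | true => .one

theorem encName_eq (n : Name) : encName n = n.map bitToken ++ [.endName] := by
  induction n with
  | nil => rfl
  | cons a n ih => cases a <;> simp [encName, bitToken, ih]

theorem encList_eq {α : Type} (e : α → List Token) (l : List α) :
    encList e l = (l.flatMap fun a => .item :: e a) ++ [.endList] := by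
  induction l with
  | nil => rfl
  | cons a l ih => simp [encList, ih]

/-- The unary code of a number. -/
def unary (k : ℕ) : Name := List.replicate k true ++ [false]

theorem unary_append_inj {k k' : ℕ} {u v : Name} (h : unary k ++ u = unary k' ++ v) :
    k = k' ∧ u = v := by
  induction k generalizing k' with
  | zero => cases k' <;> simp_all [unary, List.replicate_succ]
  | succ k ih =>
    cases k' with
    | zero => simp [unary, List.replicate_succ] at h
    | succ k' =>
      have := @ih k' (by simpa [unary, List.replicate_succ] using h)
      simpa using this

/-- The elements of a set in a finite type, in some order. -/
noncomputable def Set.elems {α : Type} [Finite α] (S : Set α) : List α :=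
  S.toFinite.toFinset.toList

@[simp] theorem Set.mem_elems {α : Type} [Finite α] {S : Set α} {a : α} : a ∈ S.elems ↔ a ∈ S := by
  simp [Set.elems]

/-! ### Uniform interpretations -/

/-- The role names in use. -/
inductive RoleKind where
  /-- from a place in the chain of a rule to the premise to be checked there -/
  | premise
  /-- from a statement to the rules with this conclusion -/
  | rule
  /-- from a place in the chain of a rule to the next one -/
  | next

/-- The concept names in use. -/
inductive ConceptKind where
  /-- the statements that hold initially -/
  | initial
  /-- the ends of the chains of the rules -/
  | last

instance : Finite RoleKind :=
  Finite.of_surjective (α := Fin 3) ![.premise, .rule, .next] (by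
    intro t
    cases t
    exacts [⟨0, rfl⟩, ⟨1, rfl⟩, ⟨2, rfl⟩])

instance : Finite ConceptKind :=
  Finite.of_surjective (α := Fin 2) ![.initial, .last] (by
    intro t
    cases t
    exacts [⟨0, rfl⟩, ⟨1, rfl⟩])

/-- The name, as a bit string. -/
def RoleKind.name : RoleKind → RoleName
  | .premise => []
  | .rule => [false]
  | .next => [true]

/-- The name, as a bit string. -/
def ConceptKind.name : ConceptKind → ConceptName
  | .initial => [false]
  | .last => [true]

theorem RoleKind.name_injective : Function.Injective RoleKind.name := by
  rintro (_ | _) (_ | _) <;> simp [name]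

theorem ConceptKind.name_injective : Function.Injective ConceptKind.name := by
  rintro (_ | _) (_ | _) <;> simp [name]

/-- A description of interpretations whose elements are the pairs of a label in `Λ` and a residue,
the place. Concepts and roles are described at every place separately, given whether the place
is `0` and the input cell with the same number. A role connects elements whose places are obtained
from the given place by shifts. -/
structure Blueprint (Λ A : Type) where
  concepts : Bool → InputCell A → Set (ConceptKind × Λ)
  roles : Bool → Set (RoleKind × (Λ × Shift) × (Λ × Shift))
  /-- The label of the distinguished element, at place `0`. -/
  root : Λ

/-- The name of an element, where the place is given by its digits. -/
noncomputable def elementName {Λ : Type} [Finite Λ] {b : ℕ} (l : Λ) (w : List (Fin (b + 2))) :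
    Name :=
  unary (Finite.equivFin Λ l) ++ w.flatMap fun a : Fin (b + 2) => unary a.val

theorem elementName_injective {Λ : Type} [Finite Λ] {b : ℕ} {l l' : Λ} {w w' : List (Fin (b + 2))}
    (h : elementName l w = elementName l' w') : l = l' ∧ w = w' := by
  rw [elementName, elementName] at h
  obtain ⟨h₁, h₂⟩ := unary_append_inj h
  refine ⟨(Finite.equivFin Λ).injective (Fin.ext h₁), ?_⟩
  clear h h₁
  induction w generalizing w' with
  | nil => cases w' <;> simp_all [unary]
  | cons a w ih =>
    cases w' with
    | nil => simp [unary] at h₂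
    | cons a' w' =>
      rw [List.flatMap_cons, List.flatMap_cons] at h₂
      obtain ⟨h₃, h₄⟩ := unary_append_inj h₂
      rw [Fin.ext h₃, ih h₄]

theorem digitWord_val_natCast (b s d : ℕ) :
    digitWord b s (d : ZMod ((b + 2) ^ s)).val = digitWord b s d := by
  rw [digitWord_eq_iff, ZMod.val_natCast]
  exact Nat.mod_modEq _ _

namespace Blueprint

variable {Λ A : Type} [Finite Λ] (D : Blueprint Λ A) (b s : ℕ)

/-- The elements of the domain. -/
noncomputable def dom (Λ : Type) [Finite Λ] (b s : ℕ) : List Name :=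
  (List.range ((b + 2) ^ s)).flatMap fun d =>
    (Set.univ : Set Λ).elems.map fun l => elementName l (digitWord b s d)

instance : NeZero ((b + 2) ^ s) := ⟨by positivity⟩

/-- The element with the given label and place. -/
noncomputable def element {b s : ℕ} (l : Λ) (z : ZMod ((b + 2) ^ s)) : {o // o ∈ dom Λ b s} :=
  ⟨elementName l (digitWord b s z.val), by
    simp only [dom, List.mem_flatMap, List.mem_map, List.mem_range]
    exact ⟨z.val, ZMod.val_lt z, l, by simp, rfl⟩⟩

theorem element_val {b s : ℕ} (l : Λ) (z : ZMod ((b + 2) ^ s)) :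
    (element l z).1 = elementName l (digitWord b s z.val) := rfl

theorem element_inj {l l' : Λ} {z z' : ZMod ((b + 2) ^ s)} :
    element l z = element l' z' ↔ l = l' ∧ z = z' := by
  refine ⟨fun h => ?_, fun h => by rw [h.1, h.2]⟩
  obtain ⟨h₁, h₂⟩ := elementName_injective (Subtype.ext_iff.1 h)
  refine ⟨h₁, ?_⟩
  rw [digitWord_eq_iff, ← ZMod.natCast_eq_natCast_iff] at h₂
  simpa using h₂

/-- The members of the concepts. -/
noncomputable def conceptList (x : List A) : List (ConceptName × {o // o ∈ dom Λ b s}) :=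
  (List.range ((b + 2) ^ s)).flatMap fun d =>
    (D.concepts (d == 0) (readInput x d)).elems.map fun r =>
      (r.1.name, element r.2 (d : ZMod ((b + 2) ^ s)))

/-- The members of the roles. -/
noncomputable def roleList :
    List (RoleName × {o // o ∈ dom Λ b s} × {o // o ∈ dom Λ b s}) :=
  (List.range ((b + 2) ^ s)).flatMap fun d =>
    (D.roles (d == 0)).elems.map fun r =>
      (r.1.name, element r.2.1.1 (r.2.1.2.onZMod (d : ZMod ((b + 2) ^ s))),
        element r.2.2.1 (r.2.2.2.onZMod (d : ZMod ((b + 2) ^ s))))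

/-- The interpretation with places modulo `(b + 2) ^ s`. -/
noncomputable def interpretation (x : List A) : FiniteInterpretation where
  dom := dom Λ b s
  concepts := D.conceptList b s x
  roles := D.roleList b s
  inds := []
  other := element D.root 0

/-- The interpretation, on the list of the elements of its domain. -/
noncomputable def interp (x : List A) : Interpretation {o // o ∈ dom Λ b s} :=
  (D.interpretation b s x).toInterpretation

variable {b s} {x : List A}

theorem mem_concept {o : {o // o ∈ dom Λ b s}} {c : ConceptKind} :
    o ∈ (D.interp b s x).concept c.name ↔
      ∃ (z : ZMod ((b + 2) ^ s)) (l : Λ),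
        (c, l) ∈ D.concepts (z.val == 0) (readInput x z.val) ∧ o = element l z := by
  change (c.name, o) ∈ D.conceptList b s x ↔ _
  simp only [conceptList, List.mem_flatMap, List.mem_range, List.mem_map, Set.mem_elems,
    Prod.mk.injEq]
  constructor
  · rintro ⟨d, hd, ⟨c', l⟩, h, hc, ho⟩
    obtain rfl := ConceptKind.name_injective hc
    exact ⟨d, l, by rwa [ZMod.val_natCast, Nat.mod_eq_of_lt hd], ho.symm⟩
  · rintro ⟨z, l, h, ho⟩
    exact ⟨z.val, ZMod.val_lt z, (c, l), h, rfl, by simpa using ho.symm⟩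

theorem mem_role {o o' : {o // o ∈ dom Λ b s}} {p : RoleKind} :
    (o, o') ∈ (D.interp b s x).role p.name ↔
      ∃ (z : ZMod ((b + 2) ^ s)) (l l' : Λ × Shift), (p, l, l') ∈ D.roles (z.val == 0) ∧
        o = element l.1 (l.2.onZMod z) ∧ o' = element l'.1 (l'.2.onZMod z) := by
  change (p.name, o, o') ∈ D.roleList b s ↔ _
  simp only [roleList, List.mem_flatMap, List.mem_range, List.mem_map, Set.mem_elems,
    Prod.mk.injEq]
  constructor
  · rintro ⟨d, hd, ⟨p', l, l'⟩, h, hp, ho, ho'⟩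
    obtain rfl := RoleKind.name_injective hp
    exact ⟨d, l, l', by rwa [ZMod.val_natCast, Nat.mod_eq_of_lt hd], ho.symm, ho'.symm⟩
  · rintro ⟨z, l, l', h, ho, ho'⟩
    exact ⟨z.val, ZMod.val_lt z, (p, l, l'), h, rfl, by simpa using ho.symm,
      by simpa using ho'.symm⟩

end Blueprint

/-! ### The query -/

/-- The expression for a role. -/
def RoleKind.expr (p : RoleKind) : NRE := .symbol (.role p.name)

/-- The expression for a test of a concept. -/
def ConceptKind.expr (c : ConceptKind) : NRE := .symbol (.testConcept c.name)

/-- This expression leads somewhere from those elements that can be derived in exactly `k` rounds: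
for a positive `k`, from the elements with a rule all of whose premises can be derived in `k - 1`
rounds. The premises of a rule are visited one after the other, so that the expression for `k - 1`
occurs only once. -/
def derivation : ℕ → NRE
  | 0 => ConceptKind.initial.expr
  | k + 1 => .comp RoleKind.rule.expr (.comp
      (.star (.comp (.test (.comp RoleKind.premise.expr (derivation k))) RoleKind.next.expr))
      ConceptKind.last.expr)

/-- The test for an element with a premise that can be derived in exactly `k` rounds. -/
def premiseTest (k : ℕ) : NRE := .test (.comp RoleKind.premise.expr (derivation k))

/-- What precedes the code of `premiseTest k` in the code of `premiseTest (k + 1)`. -/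
def queryPrefix : List Token :=
  [.test, .comp] ++ encNRE RoleKind.premise.expr ++ [.comp] ++ encNRE RoleKind.rule.expr ++
    [.comp, .star, .comp]

/-- What follows the code of `premiseTest k` in the code of `premiseTest (k + 1)`. -/
def querySuffix : List Token := encNRE RoleKind.next.expr ++ encNRE ConceptKind.last.expr

theorem encNRE_premiseTest (k : ℕ) : encNRE (premiseTest k) =
    ((List.range k).flatMap fun _ => queryPrefix) ++ encNRE (premiseTest 0) ++
      (List.range k).flatMap fun _ => querySuffix := by
  induction k with
  | zero => simp
  | succ k ih =>
    have h : encNRE (premiseTest (k + 1)) = queryPrefix ++ encNRE (premiseTest k) ++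
        querySuffix := by
      simp [premiseTest, derivation, encNRE, queryPrefix, querySuffix]
    rw [h, ih]
    nth_rw 1 [List.range_succ_eq_map]
    rw [List.range_succ]
    simp [List.flatMap_map]

namespace Blueprint

variable {Λ A : Type} [Finite Λ] (D : Blueprint Λ A)

/-- Is there a premise of the root that can be derived in exactly as many rounds as there are
places? -/
noncomputable def evalInstance (b s : ℕ) (x : List A) : EvalInstance where
  q := ⟨premiseTest ((b + 2) ^ s), [], [true], by simp⟩
  I := D.interpretation b s x
  o := element D.root 0
  o' := element D.root 0

theorem isYes_evalInstance_iff (b s : ℕ) (x : List A) : (D.evalInstance b s x).IsYes ↔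
    ∃ o u, (element D.root 0, o) ∈
        (D.interp b s x).role RoleKind.premise.name ∧
      (derivation ((b + 2) ^ s)).sem (D.interp b s x) o u := by
  have h : ∀ o o', (premiseTest ((b + 2) ^ s)).sem (D.interp b s x) o o' ↔
      o = o' ∧ ∃ u v, (o, v) ∈
        (D.interp b s x).role RoleKind.premise.name ∧
      (derivation ((b + 2) ^ s)).sem (D.interp b s x) v u :=
    fun _ _ => Iff.rfl
  constructor
  · rintro ⟨π, hπ, ho⟩
    obtain ⟨-, u, v, h₁, h₂⟩ := (h _ _).1 hπ
    rw [← (Prod.mk.inj ho).1] at h₁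
    exact ⟨v, u, h₁, h₂⟩
  · rintro ⟨v, u, h₁, h₂⟩
    exact ⟨fun _ => element D.root 0, (h _ _).2 ⟨rfl, u, v, h₁, h₂⟩, rfl⟩

/-! ### The text of an instance -/

/-- The pieces of the code of the name of an element. -/
noncomputable def elementPieces (l : Λ) (σ : Shift) : List (Piece Token) :=
  ((unary (Finite.equivFin Λ l)).map bitToken).map .tok ++ [.num σ, .tok .endName]

/-- How digits are written in names. -/
def digitCode {b : ℕ} (a : Fin (b + 2)) : List Token := (unary a.val).map bitToken

theorem render_elementPieces {b s : ℕ} (d : ℕ) (l : Λ) (σ : Shift) :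
    render digitCode (digitWord b s d) (elementPieces l σ) =
      encName (element l (σ.onZMod (d : ZMod ((b + 2) ^ s)))).1 := by
  rw [element_val, ← Shift.onWord_digitWord, digitWord_val_natCast, elementPieces, render_append,
    render_map_tok, encName_eq, elementName]
  simp only [render, List.map_append, List.map_flatMap, List.append_assoc]
  rfl

/-- The five loops for the text of an instance. -/
noncomputable def bodies (j : Fin 5) (first : Bool) (a : InputCell A) : List (Piece Token) :=
  match j with
  | 0 => queryPrefix.map .tok
  | 1 => querySuffix.map .tok
  | 2 => (Set.univ : Set Λ).elems.flatMap fun l => .tok .item :: elementPieces l .same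
  | 3 => (D.concepts first a).elems.flatMap fun r =>
      .tok .item :: ((encName r.1.name).map .tok ++ elementPieces r.2 .same)
  | 4 => (D.roles first).elems.flatMap fun r =>
      .tok .item :: ((encName r.1.name).map .tok ++
        (elementPieces r.2.1.1 r.2.1.2 ++ elementPieces r.2.2.1 r.2.2.2))

/-- What follows after the loops. -/
noncomputable def tails (j : Fin 5) : List (Piece Token) :=
  match j with
  | 0 => (encNRE (premiseTest 0)).map .tok
  | 1 => (encName [] ++ encName [true]).map .tok
  | 2 => [.tok .endList]
  | 3 => [.tok .endList]
  | 4 => [.tok .endList, .tok .endList] ++ (elementPieces D.root .zero ++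
      (elementPieces D.root .zero ++ elementPieces D.root .zero))

theorem exists_length_le [Finite A] :
    ∃ L, (∀ j f a, (D.bodies j f a).length ≤ L) ∧ ∀ j, (D.tails j).length ≤ L := by
  obtain ⟨L, hL⟩ := Set.finite_range
    (fun r : Fin 5 × Bool × InputCell A => (D.bodies r.1 r.2.1 r.2.2).length) |>.bddAbove
  obtain ⟨L', hL'⟩ := Set.finite_range (fun j => (D.tails j).length) |>.bddAbove
  exact ⟨max L L', fun j f a => le_max_of_le_left (hL ⟨(j, f, a), rfl⟩),
    fun j => le_max_of_le_right (hL' ⟨j, rfl⟩)⟩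

/-- The generator of the texts of instances. -/
noncomputable def generator [Finite A] (b : ℕ) : Generator A Token where
  b := b
  code := digitCode
  P := 4
  body := D.bodies
  tail := D.tails
  bound := D.exists_length_le.choose
  length_body_le := D.exists_length_le.choose_spec.1
  length_tail_le := D.exists_length_le.choose_spec.2

theorem text_generator [Finite A] (b : ℕ) (x : List A) :
    (D.generator b).text x = (D.evalInstance b (Generator.digits x.length) x).encode := by
  set s := Generator.digits x.length with hs
  have hsame : ∀ z : ZMod ((b + 2) ^ s), Shift.same.onZMod z = z := fun _ => rfl
  have hq := encNRE_premiseTest ((b + 2) ^ s)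
  have h0 : ∀ l : Λ, render digitCode (digitWord b s 0) (elementPieces l .zero) =
      encName (element l (0 : ZMod ((b + 2) ^ s))).1 := fun l => render_elementPieces 0 l .zero
  change ((List.finRange 5).flatMap fun j =>
    ((List.range ((b + 2) ^ s)).flatMap fun d =>
      render digitCode (digitWord b s d) (D.bodies j (d == 0) (readInput x d))) ++
    render digitCode (digitWord b s 0) (D.tails j)) = _
  have hfin : List.finRange 5 = [0, 1, 2, 3, 4] := rfl
  rw [hfin]
  simp only [List.flatMap_cons, List.flatMap_nil, List.append_nil]
  simp only [bodies, tails, render_map_tok, render_flatMap, render_append, render,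
    render_elementPieces, h0, hsame]
  simp only [EvalInstance.encode, encQuery, encInterpretation, evalInstance, interpretation, dom,
    conceptList, roleList, hq, encList_eq, List.flatMap_assoc, List.flatMap_map, element,
    digitWord_val_natCast, List.append_assoc, List.flatMap_nil, List.nil_append, List.cons_append]

end Blueprint

/-! ### Rotating machines as interpretations -/

/-- The labels of the interpretation that describes a rotating machine. -/
inductive RotorLabel (I V : Type) where
  | root
  /-- At place `z`: the statement that the cell of tape `i` at place `z` holds `v`. -/
  | cell (i : I) (v : V)
  /-- At place `z`: the rule that says what becomes of this cell if it holds `v` and `ℓ` is what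
  the heads read. The elements for the various `k` form a chain, along which the premises are
  checked. -/
  | rule (i : I) (v : V) (ℓ : I → V) (k : Fin (Nat.card I + 2))

instance {I V : Type} [Finite I] [Finite V] : Finite (RotorLabel I V) :=
  Finite.of_surjective (α := Unit ⊕ (I × V) ⊕ (I × V × (I → V) × Fin (Nat.card I + 2)))
    (fun
      | .inl _ => .root
      | .inr (.inl r) => .cell r.1 r.2
      | .inr (.inr r) => .rule r.1 r.2.1 r.2.2.1 r.2.2.2)
    (by
      rintro (_ | ⟨i, v⟩ | ⟨i, v, ℓ, k⟩)
      exacts [⟨.inl (), rfl⟩, ⟨.inr (.inl (i, v)), rfl⟩, ⟨.inr (.inr (i, v, ℓ, k)), rfl⟩])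

namespace Rotor

variable {A I V : Type} [Finite I] (R : Rotor I V)

/-- The premises of a rule: its own cell holds `v`, and the head of every tape `j`, which is at
place `0`, reads `ℓ j`. -/
noncomputable def premise (i : I) (v : V) (ℓ : I → V) :
    Fin (Nat.card I + 1) → RotorLabel I V × Shift :=
  Fin.cons (.cell i v, .same) fun j =>
    (.cell ((Finite.equivFin I).symm j) (ℓ ((Finite.equivFin I).symm j)), .zero)

/-- The concepts of the interpretation: the statements that hold initially, and the ends of the
chains. -/
inductive IsConcept (init : Bool → InputCell A → I → V) (first : Bool) (a : InputCell A) :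
    ConceptKind × RotorLabel I V → Prop
  | initial (i : I) : IsConcept init first a (.initial, .cell i (init first a i))
  | last (i : I) (v : V) (ℓ : I → V) :
    IsConcept init first a (.last, .rule i v ℓ (Fin.last _))

/-- The roles of the interpretation. The conclusion of a rule is about the place to which its cell
is turned; the cell at place `0` has been rewritten. -/
inductive IsRole (g : I) (acc : Set V) (first : Bool) :
    RoleKind × (RotorLabel I V × Shift) × (RotorLabel I V × Shift) → Prop
  | goal (v : V) (hv : v ∈ acc) : IsRole g acc first (.premise, (.root, .same), (.cell g v, .same))
  | rule (i : I) (v : V) (ℓ : I → V) :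
    IsRole g acc first (.rule, (.cell i (if first then R.write ℓ i else v), (R.move ℓ i).shift),
      (.rule i v ℓ 0, .same))
  | premise (i : I) (v : V) (ℓ : I → V) (k : Fin (Nat.card I + 1)) :
    IsRole g acc first (.premise, (.rule i v ℓ k.castSucc, .same), premise i v ℓ k)
  | next (i : I) (v : V) (ℓ : I → V) (k : Fin (Nat.card I + 1)) :
    IsRole g acc first (.next, (.rule i v ℓ k.castSucc, .same), (.rule i v ℓ k.succ, .same))

/-- The interpretation that describes the rotating machine `R`, where `init` gives the initial
contents of the tapes, and the machine accepts if a member of `acc` is read on tape `g`. -/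
def blueprint (init : Bool → InputCell A → I → V) (g : I) (acc : Set V) :
    Blueprint (RotorLabel I V) A where
  concepts first a := {r | IsConcept init first a r}
  roles first := {r | R.IsRole g acc first r}
  root := .root

variable [Finite V] {R} {init : Bool → InputCell A → I → V} {g : I} {acc : Set V} {b s : ℕ}
  {x : List A}

open Blueprint

/-- The interpretation with places modulo `(b + 2) ^ s`. -/
noncomputable abbrev interp (R : Rotor I V) (init : Bool → InputCell A → I → V) (g : I)
    (acc : Set V) (b s : ℕ) (x : List A) :
    Interpretation {o // o ∈ dom (RotorLabel I V) b s} :=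
  (R.blueprint init g acc).interp b s x

theorem mem_initial_iff {i : I} {v : V} {z : ZMod ((b + 2) ^ s)} :
    element (.cell i v) z ∈ (interp R init g acc b s x).concept ConceptKind.initial.name ↔
      init (z.val == 0) (readInput x z.val) i = v := by
  rw [mem_concept]
  constructor
  · rintro ⟨z', l, h, he⟩
    obtain ⟨rfl, rfl⟩ := (element_inj _ _).1 he
    cases h
    rfl
  · rintro rfl
    exact ⟨z, _, .initial i, rfl⟩

theorem mem_last_iff {o : {o // o ∈ dom (RotorLabel I V) b s}} :
    o ∈ (interp R init g acc b s x).concept ConceptKind.last.name ↔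
      ∃ i v ℓ z, o = element (.rule i v ℓ (Fin.last _)) z := by
  rw [mem_concept]
  constructor
  · rintro ⟨z, l, h, rfl⟩
    cases h with
    | last i v ℓ => exact ⟨i, v, ℓ, z, rfl⟩
  · rintro ⟨i, v, ℓ, z, rfl⟩
    exact ⟨z, _, .last i v ℓ, rfl⟩

theorem mem_rule_iff {i : I} {v : V} {z : ZMod ((b + 2) ^ s)}
    {o : {o // o ∈ dom (RotorLabel I V) b s}} :
    (element (.cell i v) z, o) ∈ (interp R init g acc b s x).role RoleKind.rule.name ↔
      ∃ v' ℓ z', z' = z + (R.move ℓ i).onZMod ∧ v = (if z' = 0 then R.write ℓ i else v') ∧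
        o = element (.rule i v' ℓ 0) z' := by
  rw [mem_role]
  constructor
  · rintro ⟨z', l, l', h, he, rfl⟩
    cases h with
    | rule i' v' ℓ =>
      obtain ⟨h₁, h₂⟩ := (element_inj _ _).1 he
      obtain ⟨rfl, rfl⟩ := RotorLabel.cell.inj h₁
      refine ⟨v', ℓ, z', ?_, by simp, rfl⟩
      rw [h₂, HeadMove.onZMod_shift]
      ring
  · rintro ⟨v', ℓ, z', rfl, rfl, rfl⟩
    refine ⟨_, _, _, .rule i v' ℓ, ?_, rfl⟩
    rw [HeadMove.onZMod_shift, element_inj]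
    simp

theorem mem_premise_iff {i : I} {v : V} {ℓ : I → V} {k : Fin (Nat.card I + 1)}
    {z : ZMod ((b + 2) ^ s)} {o : {o // o ∈ dom (RotorLabel I V) b s}} :
    (element (.rule i v ℓ k.castSucc) z, o) ∈
        (interp R init g acc b s x).role RoleKind.premise.name ↔
      o = element (premise i v ℓ k).1 ((premise i v ℓ k).2.onZMod z) := by
  rw [mem_role]
  constructor
  · rintro ⟨z', l, l', h, he, rfl⟩
    cases h with
    | goal v' hv => exact absurd ((element_inj _ _).1 he).1 (by simp)
    | premise i' v' ℓ' k' =>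
      obtain ⟨h₁, rfl⟩ := (element_inj _ _).1 he
      obtain ⟨rfl, rfl, rfl, h₂⟩ := RotorLabel.rule.inj h₁
      obtain rfl := Fin.castSucc_injective _ h₂
      rfl
  · rintro rfl
    exact ⟨z, _, _, .premise i v ℓ k, rfl, rfl⟩

theorem mem_next_iff {i : I} {v : V} {ℓ : I → V} {k : Fin (Nat.card I + 2)}
    {z : ZMod ((b + 2) ^ s)} {o : {o // o ∈ dom (RotorLabel I V) b s}} :
    (element (.rule i v ℓ k) z, o) ∈ (interp R init g acc b s x).role RoleKind.next.name ↔
      ∃ k' : Fin (Nat.card I + 1), k = k'.castSucc ∧ o = element (.rule i v ℓ k'.succ) z := by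
  rw [mem_role]
  constructor
  · rintro ⟨z', l, l', h, he, rfl⟩
    cases h with
    | next i' v' ℓ' k' =>
      obtain ⟨h₁, rfl⟩ := (element_inj _ _).1 he
      obtain ⟨rfl, rfl, rfl, rfl⟩ := RotorLabel.rule.inj h₁
      exact ⟨k', rfl, rfl⟩
  · rintro ⟨k', rfl, rfl⟩
    exact ⟨z, _, _, .next i v ℓ k', rfl, rfl⟩

theorem mem_root_premise_iff {o : {o // o ∈ dom (RotorLabel I V) b s}} :
    (element .root 0, o) ∈ (interp R init g acc b s x).role RoleKind.premise.name ↔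
      ∃ v ∈ acc, o = element (.cell g v) 0 := by
  rw [mem_role]
  constructor
  · rintro ⟨z', l, l', h, he, rfl⟩
    cases h with
    | goal v hv =>
      obtain ⟨-, rfl⟩ := (element_inj _ _).1 he
      exact ⟨v, hv, rfl⟩
    | premise i' v' ℓ' k' => exact absurd ((element_inj _ _).1 he).1 (by simp)
  · rintro ⟨v, hv, rfl⟩
    exact ⟨0, _, _, .goal v hv, rfl, rfl⟩

open Relation in
/-- The iterated premise tests reach the end of the chain of a rule if and only if all premises
pass. -/
theorem reflTransGen_rule_iff (F : NRE) (i : I) (v : V) (ℓ : I → V) (z : ZMod ((b + 2) ^ s)) :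
    (∃ o ∈ (interp R init g acc b s x).concept ConceptKind.last.name,
      ReflTransGen ((NRE.comp (.test (.comp RoleKind.premise.expr F)) RoleKind.next.expr).sem
        (interp R init g acc b s x)) (element (.rule i v ℓ 0) z) o) ↔
    ∀ k, ∃ u, F.sem (interp R init g acc b s x)
      (element (premise i v ℓ k).1 ((premise i v ℓ k).2.onZMod z)) u := by
  have hstep : ∀ k o, (NRE.comp (.test (.comp RoleKind.premise.expr F)) RoleKind.next.expr).sem
      (interp R init g acc b s x) (element (.rule i v ℓ k) z) o ↔
      ∃ k' : Fin (Nat.card I + 1), k = k'.castSucc ∧ o = element (.rule i v ℓ k'.succ) z ∧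
        ∃ u, F.sem (interp R init g acc b s x)
          (element (premise i v ℓ k').1 ((premise i v ℓ k').2.onZMod z)) u := by
    intro k o
    have h : (NRE.comp (.test (.comp RoleKind.premise.expr F)) RoleKind.next.expr).sem
      (interp R init g acc b s x) (element (.rule i v ℓ k) z) o ↔
      ∃ o', (element (.rule i v ℓ k) z = o' ∧ ∃ u, ∃ w, (element (.rule i v ℓ k) z, w) ∈
        (interp R init g acc b s x).role RoleKind.premise.name ∧
        F.sem (interp R init g acc b s x) w u) ∧
        (o', o) ∈ (interp R init g acc b s x).role RoleKind.next.name := Iff.rfl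
    rw [h]
    constructor
    · rintro ⟨_, ⟨rfl, u, w, hw, hF⟩, hn⟩
      obtain ⟨k', rfl, rfl⟩ := mem_next_iff.1 hn
      obtain rfl := mem_premise_iff.1 hw
      exact ⟨k', rfl, rfl, u, hF⟩
    · rintro ⟨k', rfl, rfl, u, hF⟩
      exact ⟨_, ⟨rfl, u, _, mem_premise_iff.2 rfl, hF⟩, mem_next_iff.2 ⟨k', rfl, rfl⟩⟩
  constructor
  · rintro ⟨o, ho, hr⟩
    have key : ∃ k, o = element (.rule i v ℓ k) z ∧ ∀ k' : Fin (Nat.card I + 1), k'.castSucc < k →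
        ∃ u, F.sem (interp R init g acc b s x)
          (element (premise i v ℓ k').1 ((premise i v ℓ k').2.onZMod z)) u := by
      clear ho
      induction hr with
      | refl => exact ⟨0, rfl, fun k' h => absurd h (Fin.not_lt_zero _)⟩
      | tail _ h ih =>
        obtain ⟨k, rfl, ih⟩ := ih
        obtain ⟨k', rfl, rfl, hF⟩ := (hstep _ _).1 h
        refine ⟨_, rfl, fun j hj => ?_⟩
        rcases (show j.castSucc ≤ k'.castSucc from Fin.castSucc_lt_succ_iff.1 hj).eq_or_lt with h | h
        · obtain rfl := Fin.castSucc_injective _ h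
          exact hF
        · exact ih j h
    obtain ⟨k, rfl, hk⟩ := key
    obtain ⟨_, _, _, _, h⟩ := mem_last_iff.1 ho
    obtain ⟨-, -, -, rfl⟩ := RotorLabel.rule.inj ((element_inj _ _).1 h).1
    exact fun k => hk k (Fin.castSucc_lt_last k)
  · intro h
    refine ⟨_, mem_last_iff.2 ⟨i, v, ℓ, z, rfl⟩, ?_⟩
    have : ∀ k : Fin (Nat.card I + 2),
        ReflTransGen ((NRE.comp (.test (.comp RoleKind.premise.expr F)) RoleKind.next.expr).sem
          (interp R init g acc b s x)) (element (.rule i v ℓ 0) z) (element (.rule i v ℓ k) z) := by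
      intro k
      induction k using Fin.induction with
      | zero => exact .refl
      | succ k ih => exact ih.tail ((hstep _ _).2 ⟨k, rfl, rfl, h k⟩)
    exact this _

/-- What can be derived in exactly `k` rounds are the true statements about the contents of the
tapes after `k` steps. -/
theorem derivation_iff (k : ℕ) (i : I) (v : V) (z : ZMod ((b + 2) ^ s)) :
    (∃ u, (derivation k).sem (interp R init g acc b s x) (element (.cell i v) z) u) ↔
      R.run (fun i z => init (z.val == 0) (readInput x z.val) i) k i z = v := by
  induction k generalizing i v z with
  | zero =>
    have h : ∀ u, (derivation 0).sem (interp R init g acc b s x) (element (.cell i v) z) u ↔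
      element (.cell i v) z = u ∧ element (.cell i v) z ∈
        (interp R init g acc b s x).concept ConceptKind.initial.name := fun _ => Iff.rfl
    simp only [h, exists_eq_left', mem_initial_iff, run]
  | succ k ih =>
    set c := R.run (fun i (z : ZMod ((b + 2) ^ s)) => init (z.val == 0) (readInput x z.val) i) k
      with hc
    have h : (∃ u, (derivation (k + 1)).sem (interp R init g acc b s x)
        (element (.cell i v) z) u) ↔
      ∃ w, (element (.cell i v) z, w) ∈ (interp R init g acc b s x).role RoleKind.rule.name ∧
        ∃ o ∈ (interp R init g acc b s x).concept ConceptKind.last.name,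
          Relation.ReflTransGen ((NRE.comp (.test (.comp RoleKind.premise.expr (derivation k)))
            RoleKind.next.expr).sem (interp R init g acc b s x)) w o := by
      constructor
      · rintro ⟨u, w, hw, o, ho, rfl, hl⟩
        exact ⟨w, hw, o, hl, ho⟩
      · rintro ⟨w, hw, o, hl, ho⟩
        exact ⟨o, w, hw, o, ho, rfl, hl⟩
    have hprem : ∀ v' ℓ z', (∃ o ∈ (interp R init g acc b s x).concept ConceptKind.last.name,
        Relation.ReflTransGen ((NRE.comp (.test (.comp RoleKind.premise.expr (derivation k)))
          RoleKind.next.expr).sem (interp R init g acc b s x)) (element (.rule i v' ℓ 0) z') o) ↔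
        c i z' = v' ∧ (fun j => c j 0) = ℓ := by
      intro v' ℓ z'
      rw [reflTransGen_rule_iff, Fin.forall_fin_succ]
      refine and_congr (ih i v' z') ?_
      rw [funext_iff]
      refine .trans ?_ (Finite.equivFin I).symm.surjective.forall.symm
      exact forall_congr' fun j => ih _ _ 0
    rw [h]
    change _ ↔ R.step c i z = v
    constructor
    · rintro ⟨w, hw, hr⟩
      obtain ⟨v', ℓ, z', hz, rfl, rfl⟩ := mem_rule_iff.1 hw
      obtain ⟨rfl, rfl⟩ := (hprem _ _ _).1 hr
      rw [Rotor.step, hz]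
    · intro hv
      refine ⟨_, mem_rule_iff.2 ⟨c i (z + (R.move (fun j => c j 0) i).onZMod), fun j => c j 0, _,
        rfl, ?_, rfl⟩, (hprem _ _ _).2 ⟨rfl, rfl⟩⟩
      rw [← hv, Rotor.step]

theorem isYes_iff (R : Rotor I V) (init : Bool → InputCell A → I → V) (g : I) (acc : Set V)
    (b s : ℕ) (x : List A) :
    ((R.blueprint init g acc).evalInstance b s x).IsYes ↔
      R.run (fun i (z : ZMod ((b + 2) ^ s)) => init (z.val == 0) (readInput x z.val) i)
        ((b + 2) ^ s) g 0 ∈ acc := by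
  rw [isYes_evalInstance_iff]
  constructor
  · rintro ⟨o, u, ho, hu⟩
    obtain ⟨v, hv, rfl⟩ := mem_root_premise_iff.1 ho
    rwa [(derivation_iff _ g v 0).1 ⟨u, hu⟩]
  · intro hv
    obtain ⟨u, hu⟩ := (derivation_iff (R := R) (init := init) (g := g) (acc := acc) (x := x)
      ((b + 2) ^ s) g _ (0 : ZMod ((b + 2) ^ s))).2 rfl
    exact ⟨_, u, mem_root_premise_iff.2 ⟨_, hv, rfl⟩, hu⟩

end Rotor

/-! ### Hardness -/

theorem Polynomial.exists_eval_lt_pow (p : Polynomial ℕ) :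
    ∃ e : ℕ, ∀ n, p.eval n < (n + 2) ^ e := by
  induction p using Polynomial.induction_on' with
  | add p q hp hq =>
    obtain ⟨e, he⟩ := hp
    obtain ⟨e', he'⟩ := hq
    refine ⟨e + e' + 1, fun n => ?_⟩
    rw [eval_add]
    calc p.eval n + q.eval n < (n + 2) ^ e + (n + 2) ^ e' := add_lt_add (he n) (he' n)
      _ ≤ (n + 2) ^ (e + e') + (n + 2) ^ (e + e') :=
        add_le_add (Nat.pow_le_pow_right (by omega) (by omega))
          (Nat.pow_le_pow_right (by omega) (by omega))
      _ = (n + 2) ^ (e + e') * 2 := by ring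
      _ ≤ (n + 2) ^ (e + e' + 1) := Nat.mul_le_mul_left _ (by omega)
  | monomial k a =>
    refine ⟨a + k, fun n => ?_⟩
    rw [eval_monomial, pow_add]
    calc a * n ^ k ≤ a * (n + 2) ^ k :=
          Nat.mul_le_mul_left _ (Nat.pow_le_pow_left (by omega) _)
      _ < (n + 2) ^ a * (n + 2) ^ k :=
        Nat.mul_lt_mul_of_pos_right (Nat.lt_pow_self (by omega)) (by positivity)

/-- A counter with as many digits as the length of the input has bits can count beyond any given
polynomial if its base is large enough. -/
theorem Polynomial.exists_eval_lt_digits (p : Polynomial ℕ) :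
    ∃ b : ℕ, ∀ n, p.eval n < (b + 2) ^ Generator.digits n := by
  obtain ⟨e, he⟩ := p.exists_eval_lt_pow
  refine ⟨2 ^ e, fun n => (he n).trans_le ?_⟩
  calc (n + 2) ^ e ≤ (2 ^ Generator.digits n) ^ e :=
        Nat.pow_le_pow_left (Nat.lt_size_self (n + 1)) _
    _ = (2 ^ e) ^ Generator.digits n := by rw [← pow_mul, ← pow_mul, mul_comm]
    _ ≤ _ := Nat.pow_le_pow_left (by omega) _

theorem mainTheorem4 : PTimeHard N2RPQEvaluation := by
  rintro A _ L ⟨M, acc, p, hM⟩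
  obtain ⟨b, hb⟩ := p.exists_eval_lt_digits
  have := M.finQ
  set D := M.rotor.blueprint M.initValue .state (Machine.CellValue.state '' acc)
  refine ⟨(D.generator b).text, (D.generator b).text_logSpaceComputable, fun x => ?_⟩
  rw [D.text_generator, EvalInstance.encode_mem_iff, Rotor.isYes_iff]
  obtain ⟨t, htp, ht, hacc⟩ := hM x
  have htN := htp.trans_lt (hb x.length)
  have hrun := (Machine.represents_run ht htN
    ((b + 2) ^ Generator.digits x.length)).state
  rw [Machine.cfgAt_of_haltedAt ht htN.le] at hrun
  change _ ↔ M.rotor.run (M.initTapes x _) _ .state 0 ∈ _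
  rw [hrun, ← hacc]
  simp
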